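/- **Setting.** Let $k$ be a field, $H$ a Hopf algebra over $k$ with comultiplication $\Delta h=h_{(1)}\otimes h_{(2)}$, counit $\varepsilon$ and antipode $S$, and let $P$ be a unital right $H$-comodule algebra with coaction $\Delta_R p=p_{(0)}\otimes p_{(1)}$ and algebra of coinvariants $B=\{b\in P:\Delta_R b=b\otimes 1\}$. Unadorned tensor products are over $k$. Assume that $B\subseteq P$ is an $H$-Galois extension, i.e. that $\chi:P\otimes_BP\to P\otimes H$, $p\otimes_B q\mapsto pq_{(0)}\otimes q_{(1)}$, is bijective, and write $\tau(h)=\chi^{-1}(1\otimes h)=h^{[1]}\otimes_B h^{[2]}$. Let $\Omega^1P=\ker(m:P\otimes P\to P)$, $\mathrm dp=1\otimes p-p\otimes 1$, and $(\Omega^1B)P=\ker(m:B\otimes P\to P)\subseteq\Omega^1P$. The space $\Omega^1P$ carries the restriction $\Delta_\Omega$ of the diagonal coaction $p\otimes q\mapsto p_{(0)}\otimes q_{(0)}\otimes p_{(1)}q_{(1)}$; $B\otimes P$ and $(\Omega^1B)P$ carry $b\otimes p\mapsto b\otimes p_{(0)}\otimes p_{(1)}$; and $\mathrm{ad}(h)=h_{(2)}\otimes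 S(h_{(1)})h_{(3)}$. Consider the following four sets of $k$-linear maps. 1. $V_1$: unital left $B$-linear right $H$-colinear maps $s:P\to B\otimes P$ with $m\circ s=\mathrm{id}$. 2. $V_2$: right $H$-colinear maps $D:P\to(\Omega^1B)P$ with $D(1)=0$ and $D(bp)=b\,D(p)+\mathrm db\cdot p$ for all $b\in B$, $p\in P$. 3. $V_3$: left $P$-linear right $H$-colinear maps $\Pi:\Omega^1P\to\Omega^1P$ with $\Pi^2=\Pi$ and $(\mathrm{id}-\Pi)(B\,\mathrm dP)=(\Omega^1B)P$. 4. $V_4$: maps $\omega:H\to\Omega^1P$ with $\omega(1)=0$, $\Delta_\Omega\circ\omega=(\omega\otimes\mathrm{id})\circ\mathrm{ad}$, $(m\otimes\mathrm{id})\circ(\mathrm{id}\otimes\Delta_R)\circ\omega=1\otimes(\mathrm{id}-\varepsilon)$, and $\mathrm dp-p_{(0)}\omega(p_{(1)})\in(\Omega^1B)P$ for all $p\in P$. These are the four descriptions of a strong connection. They are identified by the bijections $J_1:V_1\to V_2$, $J_2:V_2\to V_3$, $J_3:V_3\to V_4$, $J_4:V_4\to V_1$ given by $$J_1(s)(p)=1\otimes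 p-s(p),\quad J_2(D)(r\,\mathrm dp)=r(\mathrm dp-Dp),\quad J_3(\Pi)(h)=h^{[1]}\Pi(\mathrm dh^{[2]}),\quad J_4(\omega)(p)=p\otimes1+p_{(0)}\omega(p_{(1)}),$$ whose cyclic composites are identities. A gauge transformation is a unital convolution-invertible linear map $f:H\to P$ with $\Delta_R\circ f=(f\otimes\mathrm{id})\circ\mathrm{ad}$; $f^{-1}$ denotes its convolution inverse. **Theorem.** Assume that $B\subseteq P$ admits a strong connection. The gauge transformations form a group under convolution $(f*g)(h)=f(h_{(1)})g(h_{(2)})$, and the formulas 1. $(f\triangleright s)(p)=s\big(p_{(0)}f(p_{(1)})\big)f^{-1}(p_{(2)})$, 2. $(f\triangleright D)(p)=D\big(p_{(0)}f(p_{(1)})\big)f^{-1}(p_{(2)})$, 3. $(f\triangleright\Pi)(r\,\mathrm dp)=r\,\Pi\big(\mathrm d(p_{(0)}f(p_{(1)}))\big)f^{-1}(p_{(2)})+r\,p_{(0)}f(p_{(1)})\,\mathrm df^{-1}(p_{(2)})$, 4. $(f\triangleright\omega)(h)=f(h_{(1)})\,\omega(h_{(2)})\,f^{-1}(h_{(3)})+f(h_{(1)})\,\mathrm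 df^{-1}(h_{(2)})$ define left actions of this group on $V_1,V_2,V_3,V_4$, respectively. These actions are compatible with the identifications: $J_i(f\triangleright x)=f\triangleright J_i(x)$ for all $i\in\{1,2,3,4\}$, every gauge transformation $f$ and every $x\in V_i$; hence the same holds for all composites of the $J_i$. -/

import Mathlib

open scoped TensorProduct

noncomputable section

namespace HopfGalois

variable {k H P : Type*} [Field k] [Ring H] [HopfAlgebra k H] [Ring P] [Algebra k P]

/-! ### Comodule algebras, coinvariants and the canonical map -/

/-- `δ` is a right coaction: `(δ ⊗ id) ∘ δ = (id ⊗ Δ) ∘ δ` and `(id ⊗ ε) ∘ δ = id`.  Since `δ` is an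
algebra homomorphism, this makes `P` a right `H`-comodule algebra.  Sweedler notation below:
`δ p = p₍₀₎ ⊗ p₍₁₎`. -/
structure IsCoaction (δ : P →ₐ[k] P ⊗[k] H) : Prop where
  coassoc : (TensorProduct.assoc k P H H).toLinearMap ∘ₗ δ.toLinearMap.rTensor H ∘ₗ δ.toLinearMap =
    (Coalgebra.comul (R := k) (A := H)).lTensor P ∘ₗ δ.toLinearMap
  counit : (TensorProduct.rid k P).toLinearMap ∘ₗ
    (Coalgebra.counit (R := k) (A := H)).lTensor P ∘ₗ δ.toLinearMap = LinearMap.id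

/-- The algebra `B = {b | δ b = b ⊗ 1}` of coinvariants. -/
abbrev coinv (δ : P →ₐ[k] P ⊗[k] H) : Subalgebra k P :=
  AlgHom.equalizer δ Algebra.TensorProduct.includeLeft

/-- The left action `P ⊗ M → M`, `p ⊗ x ↦ p x`, of `P` on a left `P`-module. -/
def actL (k P M : Type*) [Field k] [Ring P] [Algebra k P] [AddCommGroup M] [Module k M] [Module P M]
    [IsScalarTower k P M] : P ⊗[k] M →ₗ[k] M :=
  TensorProduct.lift (Algebra.lsmul k k M).toLinearMap

/-- The right action `(M ⊗ P) ⊗ P → M ⊗ P`, `(x ⊗ p) ⊗ q ↦ x ⊗ p q`. -/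
def actR (k P M : Type*) [Field k] [Ring P] [Algebra k P] [AddCommGroup M] [Module k M] :
    (M ⊗[k] P) ⊗[k] P →ₗ[k] M ⊗[k] P :=
  (LinearMap.mul' k P).lTensor M ∘ₗ (TensorProduct.assoc k M P P).toLinearMap

/-- The map `P ⊗ P → P ⊗ H`, `p ⊗ q ↦ p q₍₀₎ ⊗ q₍₁₎`. -/
def preCan (δ : P →ₐ[k] P ⊗[k] H) : P ⊗[k] P →ₗ[k] P ⊗[k] H :=
  (LinearMap.mul' k P).rTensor H ∘ₗ (TensorProduct.assoc k P P H).symm.toLinearMap ∘ₗ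
    δ.toLinearMap.lTensor P

/-- The subspace of `P ⊗ P` spanned by the elements `p b ⊗ q - p ⊗ b q` with `b ∈ B`. -/
def balancing (δ : P →ₐ[k] P ⊗[k] H) : Submodule k (P ⊗[k] P) :=
  Submodule.span k {x | ∃ (p q : P) (b : coinv δ), x = (p * b) ⊗ₜ[k] q - p ⊗ₜ[k] (b * q)}

/-- The tensor product `P ⊗_B P` over the (noncommutative) algebra of coinvariants. -/
abbrev BalancedTensor (δ : P →ₐ[k] P ⊗[k] H) : Type _ := (P ⊗[k] P) ⧸ balancing δ

lemma coe_mul_tmul (a b : P) (t : P ⊗[k] H) :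
    (LinearMap.mul' k P).rTensor H ((TensorProduct.assoc k P P H).symm ((a * b) ⊗ₜ t)) =
    (LinearMap.mul' k P).rTensor H ((TensorProduct.assoc k P P H).symm
      (a ⊗ₜ ((b ⊗ₜ[k] (1 : H)) * t))) := by
  induction t with
  | zero => simp
  | add x y hx hy => simp only [TensorProduct.tmul_add, mul_add, map_add, hx, hy]
  | tmul x y => simp [mul_assoc]

lemma balancing_le_ker (δ : P →ₐ[k] P ⊗[k] H) : balancing δ ≤ LinearMap.ker (preCan δ) := by
  refine Submodule.span_le.2 ?_
  rintro x ⟨p, q, b, rfl⟩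
  have hb : δ (b : P) = (b : P) ⊗ₜ[k] (1 : H) := b.2
  simp only [SetLike.mem_coe, LinearMap.mem_ker, map_sub, sub_eq_zero]
  simp [preCan, coe_mul_tmul, hb]

/-- The canonical map `χ : P ⊗_B P → P ⊗ H`, `p ⊗_B q ↦ p q₍₀₎ ⊗ q₍₁₎`. -/
def can (δ : P →ₐ[k] P ⊗[k] H) : BalancedTensor δ →ₗ[k] P ⊗[k] H :=
  (balancing δ).liftQ (preCan δ) (balancing_le_ker δ)

/-- `B ⊆ P` is an `H`-Galois extension: `P` is a right `H`-comodule algebra, `B` is its algebra of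
coinvariants, and the canonical map is bijective. -/
structure IsHopfGalois (δ : P →ₐ[k] P ⊗[k] H) : Prop extends IsCoaction δ where
  bijective_can : Function.Bijective (can δ)

/-- The translation map `τ(h) = χ⁻¹(1 ⊗ h)`. -/
def translation {δ : P →ₐ[k] P ⊗[k] H} (hδ : IsHopfGalois δ) (h : H) : BalancedTensor δ :=
  (LinearEquiv.ofBijective (can δ) hδ.bijective_can).symm (1 ⊗ₜ[k] h)

/-! ### The universal differential calculus -/

/-- `Ω¹P`, the kernel of the multiplication map `P ⊗ P → P`, as a left `P`-submodule. -/
def Omega (k P : Type*) [Field k] [Ring P] [Algebra k P] : Submodule P (P ⊗[k] P) where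
  carrier := {x | LinearMap.mul' k P x = 0}
  add_mem' := by
    intro x y hx hy
    simp_all
  zero_mem' := by simp
  smul_mem' := by
    intro r x hx
    have key : ∀ y : P ⊗[k] P, LinearMap.mul' k P (r • y) = r * LinearMap.mul' k P y := by
      intro y
      induction y with
      | zero => simp
      | add a b ha hb => simp only [smul_add, map_add, mul_add, ha, hb]
      | tmul a b => simp [TensorProduct.smul_tmul', mul_assoc]
    simp only [Set.mem_ofPred_eq] at hx ⊢
    rw [key, hx, mul_zero]

/-- The inclusion `Ω¹P ⊆ P ⊗ P`. -/
def Omega.incl (k P : Type*) [Field k] [Ring P] [Algebra k P] : Omega k P →ₗ[k] P ⊗[k] P :=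
  (Omega k P).subtype.restrictScalars k

/-- The projection `P ⊗ P → Ω¹P`, `r ⊗ p ↦ r dp = r ⊗ p - r p ⊗ 1`. -/
def Omega.proj (k P : Type*) [Field k] [Ring P] [Algebra k P] : P ⊗[k] P →ₗ[k] Omega k P where
  toFun x := ⟨x - LinearMap.mul' k P x ⊗ₜ[k] 1, by
    change LinearMap.mul' k P _ = 0
    simp⟩
  map_add' x y := by
    ext
    simp [TensorProduct.add_tmul, add_sub_add_comm]
  map_smul' c x := by
    ext
    simp [TensorProduct.smul_tmul', smul_sub]

/-- The universal differential `dp = 1 ⊗ p - p ⊗ 1`. -/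
def d (k : Type*) {P : Type*} [Field k] [Ring P] [Algebra k P] : P →ₗ[k] Omega k P :=
  Omega.proj k P ∘ₗ TensorProduct.mk k P P 1

lemma coe_d (p : P) : (d k p : P ⊗[k] P) = 1 ⊗ₜ[k] p - p ⊗ₜ[k] 1 := by
  simp [d, Omega.proj]

/-- The diagonal coaction `p ⊗ q ↦ p₍₀₎ ⊗ q₍₀₎ ⊗ p₍₁₎ q₍₁₎` on `P ⊗ P`. -/
def diagCoaction (δ : P →ₐ[k] P ⊗[k] H) : P ⊗[k] P →ₗ[k] (P ⊗[k] P) ⊗[k] H :=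
  (LinearMap.mul' k H).lTensor (P ⊗[k] P) ∘ₗ
    (TensorProduct.tensorTensorTensorComm k P H P H).toLinearMap ∘ₗ
    TensorProduct.map δ.toLinearMap δ.toLinearMap

/-- The restriction of the diagonal coaction to `Ω¹P → Ω¹P ⊗ H`
(that it is this restriction is `incl_omegaCoaction`). -/
def omegaCoaction (δ : P →ₐ[k] P ⊗[k] H) : Omega k P →ₗ[k] Omega k P ⊗[k] H :=
  (Omega.proj k P).rTensor H ∘ₗ diagCoaction δ ∘ₗ Omega.incl k P

lemma mul_diagCoaction (δ : P →ₐ[k] P ⊗[k] H) (x : P ⊗[k] P) :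
    (LinearMap.mul' k P).rTensor H (diagCoaction δ x) = δ (LinearMap.mul' k P x) := by
  have key : ∀ s t : P ⊗[k] H, (LinearMap.mul' k P).rTensor H
      ((LinearMap.mul' k H).lTensor (P ⊗[k] P)
        (TensorProduct.tensorTensorTensorComm k P H P H (s ⊗ₜ t))) = s * t := by
    intro s t
    induction s with
    | zero => simp
    | add a b ha hb => simp only [TensorProduct.add_tmul, map_add, add_mul, ha, hb]
    | tmul a b =>
      induction t with
      | zero => simp
      | add a b ha hb => simp only [TensorProduct.tmul_add, map_add, mul_add, ha, hb]
      | tmul c e => simp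
  induction x with
  | zero => simp
  | add a b ha hb => simp only [map_add, ha, hb]
  | tmul p q => simp [diagCoaction, key]

lemma incl_omegaCoaction (δ : P →ₐ[k] P ⊗[k] H) (x : Omega k P) :
    (Omega.incl k P).rTensor H (omegaCoaction δ x) = diagCoaction δ (x : P ⊗[k] P) := by
  have key : Omega.incl k P ∘ₗ Omega.proj k P =
      LinearMap.id - (TensorProduct.mk k P P).flip 1 ∘ₗ LinearMap.mul' k P := rfl
  have hx : LinearMap.mul' k P (x : P ⊗[k] P) = 0 := x.2
  simp only [omegaCoaction, LinearMap.comp_apply]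
  rw [← LinearMap.comp_apply, ← LinearMap.rTensor_comp, key, LinearMap.rTensor_sub,
    LinearMap.rTensor_comp]
  simp only [LinearMap.sub_apply, LinearMap.comp_apply, mul_diagCoaction]
  simp [Omega.incl, hx]

/-- The multiplication map `B ⊗ P → P`. -/
def mulB (δ : P →ₐ[k] P ⊗[k] H) : coinv δ ⊗[k] P →ₗ[k] P := actL k (coinv δ) P

/-- The inclusion `B ⊗ P → P ⊗ P`. -/
def inclB (δ : P →ₐ[k] P ⊗[k] H) : coinv δ ⊗[k] P →ₗ[k] P ⊗[k] P :=
  (coinv δ).val.toLinearMap.rTensor P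

/-- `(Ω¹B)P`, the kernel of the multiplication map `B ⊗ P → P`. -/
def OmegaB (δ : P →ₐ[k] P ⊗[k] H) : Submodule k (coinv δ ⊗[k] P) := LinearMap.ker (mulB δ)

/-- `(Ω¹B)P` as a subspace of `P ⊗ P`. -/
def OmegaBP (δ : P →ₐ[k] P ⊗[k] H) : Submodule k (P ⊗[k] P) := (OmegaB δ).map (inclB δ)

/-- `B dP`, the span of the forms `b dp`, as a subspace of `Ω¹P`. -/
def BdP (δ : P →ₐ[k] P ⊗[k] H) : Submodule k (Omega k P) :=
  Submodule.span k {x | ∃ (b : coinv δ) (p : P), x = (b : P) • d k p}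

/-- The coaction `b ⊗ p ↦ b ⊗ p₍₀₎ ⊗ p₍₁₎` on `B ⊗ P`. -/
def coactionB (δ : P →ₐ[k] P ⊗[k] H) : coinv δ ⊗[k] P →ₗ[k] (coinv δ ⊗[k] P) ⊗[k] H :=
  (TensorProduct.assoc k (coinv δ) P H).symm.toLinearMap ∘ₗ δ.toLinearMap.lTensor (coinv δ)

/-- The right adjoint coaction `h ↦ h₍₂₎ ⊗ S(h₍₁₎) h₍₃₎`. -/
def adCoaction (k H : Type*) [Field k] [Ring H] [HopfAlgebra k H] : H →ₗ[k] H ⊗[k] H :=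
  (LinearMap.mul' k H ∘ₗ (HopfAlgebra.antipode k (A := H)).rTensor H).lTensor H ∘ₗ
    (TensorProduct.leftComm k H H H).toLinearMap ∘ₗ
    (Coalgebra.comul (R := k) (A := H)).lTensor H ∘ₗ Coalgebra.comul

/-! ### The four descriptions of a strong connection -/

/-- For `T : H → M` with values in a left `P`-module, the map `P → M`, `p ↦ p₍₀₎ T(p₍₁₎)`. -/
def coactL (δ : P →ₐ[k] P ⊗[k] H) {M : Type*} [AddCommGroup M] [Module k M] [Module P M]
    [IsScalarTower k P M] (T : H →ₗ[k] M) : P →ₗ[k] M :=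
  actL k P M ∘ₗ T.lTensor P ∘ₗ δ.toLinearMap

/-- Unital left `B`-linear right `H`-colinear splittings `s` of the multiplication `B ⊗ P → P`. -/
@[ext]
structure StrongSplitting (δ : P →ₐ[k] P ⊗[k] H) where
  toMap : P →ₗ[coinv δ] coinv δ ⊗[k] P
  map_one : toMap 1 = 1 ⊗ₜ 1
  splits : ∀ p, mulB δ (toMap p) = p
  colinear : coactionB δ ∘ₗ toMap.restrictScalars k =
    (toMap.restrictScalars k).rTensor H ∘ₗ δ.toLinearMap

/-- Right `H`-colinear maps `D : P → (Ω¹B)P` with `D 1 = 0` and the Leibniz rule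
`D(b p) = b D p + db.p`, where `db.p = 1 ⊗ b p - b ⊗ p`. -/
@[ext]
structure CovariantDifferential (δ : P →ₐ[k] P ⊗[k] H) where
  toMap : P →ₗ[k] coinv δ ⊗[k] P
  mem : ∀ p, toMap p ∈ OmegaB δ
  map_one : toMap 1 = 0
  leibniz : ∀ (b : coinv δ) (p : P),
    toMap (b * p) = b • toMap p + (1 ⊗ₜ[k] ((b : P) * p) - b ⊗ₜ[k] p)
  colinear : coactionB δ ∘ₗ toMap = toMap.rTensor H ∘ₗ δ.toLinearMap

/-- Left `P`-linear right `H`-colinear projections `Π` on `Ω¹P` with `(id - Π)(B dP) = (Ω¹B)P`. -/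
@[ext]
structure StrongConnection (δ : P →ₐ[k] P ⊗[k] H) where
  toMap : Omega k P →ₗ[P] Omega k P
  idem : ∀ x, toMap (toMap x) = toMap x
  colinear : omegaCoaction δ ∘ₗ toMap.restrictScalars k =
    (toMap.restrictScalars k).rTensor H ∘ₗ omegaCoaction δ
  strong : (BdP δ).map (Omega.incl k P ∘ₗ (LinearMap.id - toMap.restrictScalars k)) = OmegaBP δ

/-- Strong connection forms `ω : H → Ω¹P`. -/
@[ext]
structure StrongConnectionForm (δ : P →ₐ[k] P ⊗[k] H) where
  toMap : H →ₗ[k] Omega k P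
  map_one : toMap 1 = 0
  colinear : omegaCoaction δ ∘ₗ toMap = toMap.rTensor H ∘ₗ adCoaction k H
  vertical : ∀ h, preCan δ (toMap h : P ⊗[k] P) =
    1 ⊗ₜ[k] (h - algebraMap k H (Coalgebra.counit h))
  strong : ∀ p, (d k p - coactL δ toMap p : P ⊗[k] P) ∈ OmegaBP δ

/-! ### Gauge transformations -/

/-- A gauge transformation: a convolution-invertible linear map `f : H → P` that is unital and
satisfies `δ ∘ f = (f ⊗ id) ∘ ad`.  The ring structure on `WithConv (H →ₗ[k] P)` is convolution. -/
structure IsGauge (δ : P →ₐ[k] P ⊗[k] H) (f : (WithConv (H →ₗ[k] P))ˣ) : Prop where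
  map_one : f.val.ofConv 1 = 1
  colinear : δ.toLinearMap ∘ₗ f.val.ofConv = f.val.ofConv.rTensor H ∘ₗ adCoaction k H

variable (δ : P →ₐ[k] P ⊗[k] H) (f : (WithConv (H →ₗ[k] P))ˣ)

/-- For `T : P → M ⊗ P`, the map `p ↦ T(p₍₀₎ f(p₍₁₎)) f⁻¹(p₍₂₎)`. -/
def gaugeTwist {M : Type*} [AddCommGroup M] [Module k M] (T : P →ₗ[k] M ⊗[k] P) :
    P →ₗ[k] M ⊗[k] P :=
  actR k P M ∘ₗ TensorProduct.map (T ∘ₗ coactL δ f.val.ofConv) f.inv.ofConv ∘ₗ δ.toLinearMap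

/-- The map `p ↦ Π(d(p₍₀₎ f(p₍₁₎))) f⁻¹(p₍₂₎) + p₍₀₎ f(p₍₁₎) d f⁻¹(p₍₂₎)`. -/
def gaugeConnection (Q : Omega k P →ₗ[P] Omega k P) : P →ₗ[k] P ⊗[k] P :=
  gaugeTwist δ f (Omega.incl k P ∘ₗ Q.restrictScalars k ∘ₗ d k) +
    actL k P (P ⊗[k] P) ∘ₗ
      TensorProduct.map (coactL δ f.val.ofConv) (Omega.incl k P ∘ₗ d k ∘ₗ f.inv.ofConv) ∘ₗ
      δ.toLinearMap

/-- The map `h ↦ f(h₍₁₎) ω(h₍₂₎) f⁻¹(h₍₃₎) + f(h₍₁₎) d f⁻¹(h₍₂₎)`. -/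
def gaugeForm (w : H →ₗ[k] Omega k P) : H →ₗ[k] P ⊗[k] P :=
  actL k P (P ⊗[k] P) ∘ₗ
      TensorProduct.map f.val.ofConv
        (actR k P P ∘ₗ TensorProduct.map (Omega.incl k P ∘ₗ w) f.inv.ofConv ∘ₗ
          Coalgebra.comul) ∘ₗ
      Coalgebra.comul +
    actL k P (P ⊗[k] P) ∘ₗ
      TensorProduct.map f.val.ofConv (Omega.incl k P ∘ₗ d k ∘ₗ f.inv.ofConv) ∘ₗ
      Coalgebra.comul

end HopfGalois

end

/-!
The four descriptions of a strong connection are governed by one map, the vertical part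
`N p = dp - Dp = Π(dp) = p₍₀₎ ω(p₍₁₎)` of the universal differential. The Galois condition says that
`T ↦ (p ↦ p₍₀₎ T(p₍₁₎))` is a bijection from linear maps `H → M` onto left `B`-linear maps `P → M`,
so `N` determines `ω`, and a left `P`-linear map on `Ω¹P` is determined by its values on `dP`, so
`N` determines `Π`.

Shifted by `p ⊗ 1`, the map `N` becomes the splitting `s`, on which gauge transformations act by the
homogeneous twist `s ↦ s(p₍₀₎ f(p₍₁₎)) f⁻¹(p₍₂₎)`. The inhomogeneous terms of the action on `Π` and
`ω` come from this shift, since `df⁻¹ = 1 ⊗ f⁻¹ - f⁻¹ ⊗ 1`. The twist is an action because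
`f ↦ (p ↦ p₍₀₎ f(p₍₁₎))` turns convolution of gauge transformations into composition in the opposite
order.

Maps `P → A` form a right module over the convolution algebra of maps `H → A`, through
`p ↦ N(p₍₀₎) T(p₍₁₎)`. With `u h = 1 ⊗ h`, colinearity of `N` reads `ρ ∘ N = (N ⊗ 1) * u`, and
covariance of `T : H → A` under the adjoint coaction reads `u * (ρ ∘ T) = (T ⊗ 1) * u`. Hence gauge
transformations are the units intertwined by `u`, and every covariance statement is a computation in
this module.
-/

noncomputable section

namespace HopfGalois

open WithConv

variable {k H P A A' : Type*} [Field k] [Ring H] [HopfAlgebra k H] [Ring P] [Algebra k P]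
  [Ring A] [Algebra k A] [Ring A'] [Algebra k A']

/-! ### Colinear maps and convolution -/

section Convolution

/-- Postcomposition with an algebra homomorphism, on convolution algebras. -/
def convMap (H : Type*) [Ring H] [HopfAlgebra k H] (i : A →ₐ[k] A') :
    WithConv (H →ₗ[k] A) →+* WithConv (H →ₗ[k] A') where
  toFun T := toConv (i.toLinearMap ∘ₗ T.ofConv)
  map_one' := by ext; simp [LinearMap.convOne_def]
  map_mul' _ _ := congrArg toConv (LinearMap.algHom_comp_convMul_distrib i _ _)
  map_zero' := by ext; simp
  map_add' _ _ := by ext; simp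

lemma ofConv_convMap (i : A →ₐ[k] A') (T : WithConv (H →ₗ[k] A)) :
    (convMap H i T).ofConv = i.toLinearMap ∘ₗ T.ofConv := rfl

lemma convMul_apply_one (T U : WithConv (H →ₗ[k] A)) :
    (T * U).ofConv 1 = T.ofConv 1 * U.ofConv 1 := by
  simp [LinearMap.convMul_def, Algebra.TensorProduct.one_def]

/-- The algebra homomorphism `a ↦ a ⊗ 1`. -/
abbrev inclLeft (k A C : Type*) [Field k] [Ring A] [Algebra k A] [Ring C] [Algebra k C] :
    A →ₐ[k] A ⊗[k] C := Algebra.TensorProduct.includeLeft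

/-- The algebra homomorphism `c ↦ 1 ⊗ c`. -/
abbrev inclRight (k A C : Type*) [Field k] [Ring A] [Algebra k A] [Ring C] [Algebra k C] :
    C →ₐ[k] A ⊗[k] C := Algebra.TensorProduct.includeRight

/-- The inclusion `h ↦ 1 ⊗ h` as a unit of the convolution algebra of maps `H → A ⊗ H`; its inverse
is `h ↦ 1 ⊗ S h`. -/
def convUnit (k H A : Type*) [Field k] [Ring H] [HopfAlgebra k H] [Ring A] [Algebra k A] :
    (WithConv (H →ₗ[k] A ⊗[k] H))ˣ :=
  Units.map (convMap H (inclRight k A H)).toMonoidHom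
    ⟨toConv LinearMap.id, toConv (HopfAlgebra.antipode k), LinearMap.id_mul_antipode,
      LinearMap.antipode_mul_id⟩

end Convolution

section Colinear

variable {M M' M'' : Type*} [AddCommGroup M] [Module k M] [AddCommGroup M'] [Module k M']
  [AddCommGroup M''] [Module k M'']

/-- Right `H`-colinearity of `N` for coactions `ρ` and `σ`, which may be arbitrary linear maps. -/
def IsColinear (ρ : M →ₗ[k] M ⊗[k] H) (σ : M' →ₗ[k] M' ⊗[k] H) (N : M →ₗ[k] M') : Prop :=
  σ ∘ₗ N = N.rTensor H ∘ₗ ρ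

variable {ρ : M →ₗ[k] M ⊗[k] H} {σ : M' →ₗ[k] M' ⊗[k] H} {τ : M'' →ₗ[k] M'' ⊗[k] H}
  {N N' : M →ₗ[k] M'} {L : M' →ₗ[k] M''}

lemma isColinear_id : IsColinear ρ ρ LinearMap.id := by
  rw [IsColinear, LinearMap.rTensor_id, LinearMap.id_comp, LinearMap.comp_id]

lemma IsColinear.comp (hL : IsColinear σ τ L) (hN : IsColinear ρ σ N) :
    IsColinear ρ τ (L ∘ₗ N) := by
  rw [IsColinear, ← LinearMap.comp_assoc, hL, LinearMap.comp_assoc, hN, LinearMap.rTensor_comp,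
    LinearMap.comp_assoc]

lemma IsColinear.sub (hN : IsColinear ρ σ N) (hN' : IsColinear ρ σ N') :
    IsColinear ρ σ (N - N') := by
  rw [IsColinear, LinearMap.comp_sub, hN, hN', LinearMap.rTensor_sub, LinearMap.sub_comp]

lemma IsColinear.comp_iff (hL : IsColinear σ τ L) (hinj : Function.Injective L) :
    IsColinear ρ τ (L ∘ₗ N) ↔ IsColinear ρ σ N := by
  refine ⟨fun h ↦ ?_, hL.comp⟩
  have hinj' : Function.Injective (L.rTensor H) :=
    Module.Flat.rTensor_preserves_injective_linearMap L hinj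
  rw [IsColinear, ← LinearMap.cancel_left hinj', ← LinearMap.comp_assoc, ← hL,
    LinearMap.comp_assoc, h, LinearMap.rTensor_comp, LinearMap.comp_assoc]

lemma toConv_rTensor_comp_adCoaction (T : H →ₗ[k] A) :
    toConv (T.rTensor H ∘ₗ adCoaction k H) = ((convUnit k H A)⁻¹).val *
      (convMap H (inclLeft k A H) (toConv T) * (convUnit k H A).val) := by
  have h : T.rTensor H ∘ₗ
      (LinearMap.mul' k H ∘ₗ (HopfAlgebra.antipode k (A := H)).rTensor H).lTensor H ∘ₗ
        (TensorProduct.leftComm k H H H).toLinearMap =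
      LinearMap.mul' k (A ⊗[k] H) ∘ₗ TensorProduct.map ((convUnit k H A)⁻¹).val.ofConv
        (LinearMap.mul' k (A ⊗[k] H) ∘ₗ
          TensorProduct.map ((inclLeft k A H).toLinearMap ∘ₗ T) (convUnit k H A).val.ofConv) := by
    ext a b c
    change T b ⊗ₜ[k] (HopfAlgebra.antipode k a * c) =
      (1 ⊗ₜ[k] HopfAlgebra.antipode k a) * ((T b ⊗ₜ[k] 1) * (1 ⊗ₜ[k] c))
    simp
  apply ofConv_injective
  simp only [LinearMap.convMul_def, ofConv_convMap]
  rw [← LinearMap.comp_assoc _ (TensorProduct.map ((inclLeft k A H).toLinearMap ∘ₗ T) _),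
    ← LinearMap.map_comp_lTensor]
  exact congrArg (· ∘ₗ (Coalgebra.comul (R := k) (A := H)).lTensor H ∘ₗ Coalgebra.comul) h

lemma isColinear_adCoaction_iff {ρ : A →ₗ[k] A ⊗[k] H} {T : H →ₗ[k] A} :
    IsColinear (adCoaction k H) ρ T ↔
      (convUnit k H A).val * toConv (ρ ∘ₗ T) =
        convMap H (inclLeft k A H) (toConv T) * (convUnit k H A).val := by
  rw [← Units.eq_inv_mul_iff_mul_eq, ← toConv_rTensor_comp_adCoaction, toConv_injective.eq_iff,
    IsColinear]

end Colinear

section CoactMul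

/-- For `N : P → A` and `T : H → A`, the map `p ↦ N(p₍₀₎) T(p₍₁₎)`; this makes the maps `P → A` a
right module over the convolution algebra of maps `H → A`. -/
def coactMul (δ : P →ₐ[k] P ⊗[k] H) (N : P →ₗ[k] A) (T : WithConv (H →ₗ[k] A)) : P →ₗ[k] A :=
  LinearMap.mul' k A ∘ₗ TensorProduct.map N T.ofConv ∘ₗ δ.toLinearMap

variable {δ : P →ₐ[k] P ⊗[k] H} {ρ : A →ₗ[k] A ⊗[k] H} {N : P →ₗ[k] A}
  {T : WithConv (H →ₗ[k] A)}

lemma comp_coactMul {L : A →ₗ[k] A'} {N' : P →ₗ[k] A'} {T' : WithConv (H →ₗ[k] A')}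
    (h : ∀ p g, L (N p * T.ofConv g) = N' p * T'.ofConv g) :
    L ∘ₗ coactMul δ N T = coactMul δ N' T' :=
  congrArg (· ∘ₗ δ.toLinearMap) (TensorProduct.ext' h :
    L ∘ₗ LinearMap.mul' k A ∘ₗ TensorProduct.map N T.ofConv =
      LinearMap.mul' k A' ∘ₗ TensorProduct.map N' T'.ofConv)

lemma algHom_comp_coactMul (i : A →ₐ[k] A') (N : P →ₗ[k] A) (T : WithConv (H →ₗ[k] A)) :
    i.toLinearMap ∘ₗ coactMul δ N T = coactMul δ (i.toLinearMap ∘ₗ N) (convMap H i T) :=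
  comp_coactMul fun p g ↦ map_mul i (N p) (T.ofConv g)

lemma coactMul_comp {φ : P →ₗ[k] P} (hφ : IsColinear δ.toLinearMap δ.toLinearMap φ)
    (N : P →ₗ[k] A) (T : WithConv (H →ₗ[k] A)) :
    coactMul δ N T ∘ₗ φ = coactMul δ (N ∘ₗ φ) T := by
  rw [coactMul, coactMul, LinearMap.comp_assoc, LinearMap.comp_assoc, hφ,
    ← LinearMap.map_comp_rTensor, LinearMap.comp_assoc]

lemma coactMul_coactMul (hδ : IsCoaction δ) (N : P →ₗ[k] A) (T U : WithConv (H →ₗ[k] A)) :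
    coactMul δ (coactMul δ N T) U = coactMul δ N (T * U) := by
  have h : LinearMap.mul' k A ∘ₗ
      TensorProduct.map (LinearMap.mul' k A ∘ₗ TensorProduct.map N T.ofConv) U.ofConv =
      LinearMap.mul' k A ∘ₗ TensorProduct.map N
        (LinearMap.mul' k A ∘ₗ TensorProduct.map T.ofConv U.ofConv) ∘ₗ
        (TensorProduct.assoc k P H H).toLinearMap := by
    ext p g h
    simp [mul_assoc]
  calc coactMul δ (coactMul δ N T) U
      = (LinearMap.mul' k A ∘ₗ
          TensorProduct.map (LinearMap.mul' k A ∘ₗ TensorProduct.map N T.ofConv) U.ofConv) ∘ₗ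
            δ.toLinearMap.rTensor H ∘ₗ δ.toLinearMap := by
        exact congrArg (LinearMap.mul' k A ∘ₗ · ∘ₗ δ.toLinearMap)
          (LinearMap.map_comp_rTensor _ (LinearMap.mul' k A ∘ₗ TensorProduct.map N T.ofConv)
            U.ofConv δ.toLinearMap).symm
    _ = (LinearMap.mul' k A ∘ₗ TensorProduct.map N
          (LinearMap.mul' k A ∘ₗ TensorProduct.map T.ofConv U.ofConv)) ∘ₗ
            (Coalgebra.comul (R := k) (A := H)).lTensor P ∘ₗ δ.toLinearMap := by
        rw [h, ← hδ.coassoc]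
        rfl
    _ = coactMul δ N (T * U) := by
        exact congrArg (LinearMap.mul' k A ∘ₗ · ∘ₗ δ.toLinearMap)
          (LinearMap.map_comp_lTensor _ N
            (LinearMap.mul' k A ∘ₗ TensorProduct.map T.ofConv U.ofConv) Coalgebra.comul)

lemma coactMul_one (hδ : IsCoaction δ) (N : P →ₗ[k] A) : coactMul δ N 1 = N := by
  have h : LinearMap.mul' k A ∘ₗ TensorProduct.map N (1 : WithConv (H →ₗ[k] A)).ofConv =
      N ∘ₗ (TensorProduct.rid k P).toLinearMap ∘ₗ
        (Coalgebra.counit (R := k) (A := H)).lTensor P := by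
    ext p g
    simp [LinearMap.convOne_def, Algebra.algebraMap_eq_smul_one]
  calc coactMul δ N 1 = N ∘ₗ (TensorProduct.rid k P).toLinearMap ∘ₗ
        (Coalgebra.counit (R := k) (A := H)).lTensor P ∘ₗ δ.toLinearMap :=
      congrArg (· ∘ₗ δ.toLinearMap) h
    _ = N := by rw [hδ.counit, LinearMap.comp_id]

lemma coactMul_add_left (N N' : P →ₗ[k] A) (T : WithConv (H →ₗ[k] A)) :
    coactMul δ (N + N') T = coactMul δ N T + coactMul δ N' T := by
  simp only [coactMul, TensorProduct.map_add_left, LinearMap.comp_add, LinearMap.add_comp]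

lemma coactMul_add_right (N : P →ₗ[k] A) (T U : WithConv (H →ₗ[k] A)) :
    coactMul δ N (T + U) = coactMul δ N T + coactMul δ N U := by
  simp only [coactMul, ofConv_add, TensorProduct.map_add_right, LinearMap.comp_add,
    LinearMap.add_comp]

lemma coactMul_apply_one (N : P →ₗ[k] A) (T : WithConv (H →ₗ[k] A)) :
    coactMul δ N T 1 = N 1 * T.ofConv 1 := by
  simp [coactMul, Algebra.TensorProduct.one_def]

lemma coaction_coinv_mul (b : coinv δ) (p : P) : δ (b * p) = (b : P) • δ p := by
  rw [map_mul, show δ b = (b : P) ⊗ₜ 1 from b.2, ← smul_one_mul, Algebra.TensorProduct.one_def,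
    TensorProduct.smul_tmul', smul_eq_mul, mul_one]

lemma coactMul_coinv_mul {b : coinv δ} {a : A} (hN : ∀ p, N (b * p) = a * N p) (p : P) :
    coactMul δ N T (b * p) = a * coactMul δ N T p := by
  simp only [coactMul, LinearMap.comp_apply, AlgHom.toLinearMap_apply, coaction_coinv_mul]
  induction δ p with
  | zero => simp
  | add x y hx hy => simp only [smul_add, map_add, mul_add, hx, hy]
  | tmul q g => simp [TensorProduct.smul_tmul', hN, mul_assoc]

lemma rTensor_comp_coaction (N : P →ₗ[k] A) :
    N.rTensor H ∘ₗ δ.toLinearMap =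
      coactMul δ ((inclLeft k A H).toLinearMap ∘ₗ N) (convUnit k H A).val := by
  have h : N.rTensor H = LinearMap.mul' k (A ⊗[k] H) ∘ₗ
      TensorProduct.map ((inclLeft k A H).toLinearMap ∘ₗ N) (convUnit k H A).val.ofConv := by
    ext p h
    change N p ⊗ₜ[k] h = (N p ⊗ₜ[k] 1) * (1 ⊗ₜ[k] h)
    simp
  exact congrArg (· ∘ₗ δ.toLinearMap) h

lemma isColinear_iff_comp_eq_coactMul : IsColinear δ.toLinearMap ρ N ↔
    ρ ∘ₗ N = coactMul δ ((inclLeft k A H).toLinearMap ∘ₗ N) (convUnit k H A).val := by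
  rw [IsColinear, rTensor_comp_coaction]

lemma isColinear_coactMul_iff (hδ : IsCoaction δ)
    (hρ : ∀ p h, ρ (N p * T.ofConv h) = ρ (N p) * ρ (T.ofConv h))
    (hN : IsColinear δ.toLinearMap ρ N) :
    IsColinear δ.toLinearMap ρ (coactMul δ N T) ↔
      coactMul δ ((inclLeft k A H).toLinearMap ∘ₗ N)
          ((convUnit k H A).val * toConv (ρ ∘ₗ T.ofConv)) =
        coactMul δ ((inclLeft k A H).toLinearMap ∘ₗ N)
          (convMap H (inclLeft k A H) T * (convUnit k H A).val) := by
  rw [isColinear_iff_comp_eq_coactMul,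
    comp_coactMul (N' := ρ ∘ₗ N) (T' := toConv (ρ ∘ₗ T.ofConv)) hρ, algHom_comp_coactMul,
    isColinear_iff_comp_eq_coactMul.1 hN, coactMul_coactMul hδ, coactMul_coactMul hδ]

lemma IsColinear.coactMul (hδ : IsCoaction δ)
    (hρ : ∀ p h, ρ (N p * T.ofConv h) = ρ (N p) * ρ (T.ofConv h))
    (hN : IsColinear δ.toLinearMap ρ N) (hT : IsColinear (adCoaction k H) ρ T.ofConv) :
    IsColinear δ.toLinearMap ρ (coactMul δ N T) := by
  rw [isColinear_coactMul_iff hδ hρ hN, isColinear_adCoaction_iff.1 hT, toConv_ofConv]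

end CoactMul

section GaugeGroup

variable {δ : P →ₐ[k] P ⊗[k] H} {f g : (WithConv (H →ₗ[k] P))ˣ}

lemma isGauge_iff_convUnit_mul : IsGauge δ f ↔ f.val.ofConv 1 = 1 ∧
    (convUnit k H P).val * convMap H δ f.val =
      convMap H (inclLeft k P H) f.val * (convUnit k H P).val := by
  refine ⟨fun hf ↦ ⟨hf.map_one, ?_⟩, fun hf ↦ ⟨hf.1, ?_⟩⟩
  · exact isColinear_adCoaction_iff.1 hf.colinear
  · exact isColinear_adCoaction_iff.2 hf.2

lemma IsGauge.one : IsGauge δ (1 : (WithConv (H →ₗ[k] P))ˣ) := by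
  rw [isGauge_iff_convUnit_mul]
  exact ⟨by simp [LinearMap.convOne_def], by simp⟩

lemma IsGauge.mul (hf : IsGauge δ f) (hg : IsGauge δ g) : IsGauge δ (f * g) := by
  rw [isGauge_iff_convUnit_mul] at *
  refine ⟨by rw [Units.val_mul, convMul_apply_one, hf.1, hg.1, mul_one], ?_⟩
  rw [Units.val_mul, map_mul, map_mul, ← mul_assoc, hf.2, mul_assoc, hg.2, mul_assoc]

lemma IsGauge.inv_map_one (hf : IsGauge δ f) : (f⁻¹).val.ofConv 1 = 1 := by
  rw [← one_mul ((f⁻¹).val.ofConv 1), ← hf.map_one, ← convMul_apply_one, Units.mul_inv,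
    hf.map_one]
  simp [LinearMap.convOne_def]

lemma IsGauge.inv (hf : IsGauge δ f) : IsGauge δ f⁻¹ := by
  refine isGauge_iff_convUnit_mul.2 ⟨hf.inv_map_one, ?_⟩
  have h : SemiconjBy (convUnit k H P).val (Units.map (convMap H δ).toMonoidHom f)
      (Units.map (convMap H (inclLeft k P H)).toMonoidHom f) := (isGauge_iff_convUnit_mul.1 hf).2
  exact h.units_inv_right

/-- The group of gauge transformations under convolution. -/
def gaugeGroup (δ : P →ₐ[k] P ⊗[k] H) : Subgroup (WithConv (H →ₗ[k] P))ˣ where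
  carrier := {f | IsGauge δ f}
  one_mem' := .one
  mul_mem' := .mul
  inv_mem' := .inv

end GaugeGroup

/-! ### Gauge transformations of maps into a tensor product -/

section ExtendLeft

variable {V M M' : Type*} [AddCommGroup V] [Module k V]
  [AddCommGroup M] [Module k M] [Module P M] [IsScalarTower k P M]
  [AddCommGroup M'] [Module k M'] [Module P M'] [IsScalarTower k P M']

/-- The left `P`-linear map `p ⊗ v ↦ p E(v)`. -/
def extendLeft (E : V →ₗ[k] M) : P ⊗[k] V →ₗ[P] M :=
  TensorProduct.AlgebraTensorModule.lift (LinearMap.toSpanSingleton P (V →ₗ[k] M) E)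

lemma extendLeft_tmul (E : V →ₗ[k] M) (p : P) (v : V) : extendLeft E (p ⊗ₜ v) = p • E v := rfl

lemma extendLeft_eq_actL (E : V →ₗ[k] M) (x : P ⊗[k] V) :
    extendLeft E x = actL k P M (E.lTensor P x) :=
  LinearMap.congr_fun (TensorProduct.ext' fun _ _ ↦ rfl :
    (extendLeft E).restrictScalars k = actL k P M ∘ₗ E.lTensor P) x

lemma map_extendLeft (L : M →ₗ[P] M') (E : V →ₗ[k] M) (x : P ⊗[k] V) :
    L (extendLeft E x) = extendLeft (L.restrictScalars k ∘ₗ E) x :=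
  LinearMap.congr_fun (TensorProduct.AlgebraTensorModule.ext fun p v ↦ map_smul L p (E v) :
    L ∘ₗ extendLeft E = extendLeft (L.restrictScalars k ∘ₗ E)) x

variable {δ : P →ₐ[k] P ⊗[k] H}

lemma coactL_apply (T : H →ₗ[k] M) (p : P) : coactL δ T p = extendLeft T (δ p) :=
  (extendLeft_eq_actL T (δ p)).symm

lemma coactL_apply_one (T : H →ₗ[k] M) : coactL δ T 1 = T 1 := by
  rw [coactL_apply, map_one, Algebra.TensorProduct.one_def, extendLeft_tmul, one_smul]

lemma comp_coactL (L : M →ₗ[P] M') (T : H →ₗ[k] M) :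
    L.restrictScalars k ∘ₗ coactL δ T = coactL δ (L.restrictScalars k ∘ₗ T) := by
  ext p
  simp only [LinearMap.comp_apply, LinearMap.restrictScalars_apply, coactL_apply, map_extendLeft]

lemma coactL_coinv_mul (T : H →ₗ[k] M) (b : coinv δ) (p : P) :
    coactL δ T (b * p) = (b : P) • coactL δ T p := by
  rw [coactL_apply, coactL_apply, coaction_coinv_mul, map_smul]

lemma preCan_eq_extendLeft (x : P ⊗[k] P) : preCan δ x = extendLeft δ.toLinearMap x := by
  refine LinearMap.congr_fun (TensorProduct.ext' fun p q ↦ ?_ :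
    preCan δ = (extendLeft δ.toLinearMap).restrictScalars k) x
  simp only [preCan, LinearMap.comp_apply, LinearMap.lTensor_tmul, AlgHom.toLinearMap_apply,
    LinearEquiv.coe_coe, LinearMap.restrictScalars_apply, extendLeft_tmul]
  induction δ q with
  | zero => simp
  | add x y hx hy => simp only [TensorProduct.tmul_add, map_add, smul_add, hx, hy]
  | tmul a h => simp [TensorProduct.smul_tmul']

lemma extendLeft_coactL (T : H →ₗ[k] M) (x : P ⊗[k] P) :
    extendLeft (coactL δ T) x = extendLeft T (preCan δ x) := by
  rw [preCan_eq_extendLeft, map_extendLeft]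
  congr 2
  ext p
  exact coactL_apply T p

end ExtendLeft

section ActionFormulas

variable {δ : P →ₐ[k] P ⊗[k] H} {V W M M' : Type*} [AddCommGroup V] [Module k V]
  [AddCommGroup W] [Module k W] [AddCommGroup M] [Module k M] [AddCommGroup M'] [Module k M']

lemma actL_comp_map [Module P A] [IsScalarTower k P A] [IsScalarTower P A A] {i : P →ₐ[k] A}
    (hi : ∀ r, i r = r • (1 : A)) (N : V →ₗ[k] P) (T : W →ₗ[k] A) :
    actL k P A ∘ₗ TensorProduct.map N T =
      LinearMap.mul' k A ∘ₗ TensorProduct.map (i.toLinearMap ∘ₗ N) T := by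
  ext v w
  simp [actL, hi]

lemma inclLeft_eq_smul_one (r : P) : inclLeft k P A r = r • (1 : P ⊗[k] A) := by
  simp [Algebra.TensorProduct.one_def, TensorProduct.smul_tmul']

lemma actR_comp_map (N : V →ₗ[k] A ⊗[k] P) (T : W →ₗ[k] P) :
    actR k P A ∘ₗ TensorProduct.map N T =
      LinearMap.mul' k (A ⊗[k] P) ∘ₗ
        TensorProduct.map N ((inclRight k A P).toLinearMap ∘ₗ T) := by
  refine TensorProduct.ext' fun v w ↦ ?_
  simp only [LinearMap.comp_apply, TensorProduct.map_tmul, actR]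
  induction N v with
  | zero => simp
  | add x y hx hy => simp only [TensorProduct.add_tmul, map_add, hx, hy]
  | tmul a p => simp

lemma coactL_eq_coactMul [Module P A] [IsScalarTower k P A] [IsScalarTower P A A] {i : P →ₐ[k] A}
    (hi : ∀ r, i r = r • (1 : A)) (T : H →ₗ[k] A) :
    coactL δ T = coactMul δ i.toLinearMap (toConv T) :=
  congrArg (· ∘ₗ δ.toLinearMap) (actL_comp_map hi LinearMap.id T)

lemma coactL_self (T : H →ₗ[k] P) : coactL δ T = coactMul δ LinearMap.id (toConv T) :=
  coactL_eq_coactMul (i := AlgHom.id k P) (fun r ↦ (mul_one r).symm) T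

lemma inclLeft_comp_coactL (T : H →ₗ[k] P) : (inclLeft k P A).toLinearMap ∘ₗ coactL δ T =
    coactMul δ (inclLeft k P A).toLinearMap (convMap H (inclLeft k P A) (toConv T)) := by
  rw [coactL_self, algHom_comp_coactMul, LinearMap.comp_id]

lemma gaugeTwist_eq_coactMul (f : (WithConv (H →ₗ[k] P))ˣ) (T : P →ₗ[k] A ⊗[k] P) :
    gaugeTwist δ f T =
      coactMul δ (T ∘ₗ coactL δ f.val.ofConv) (convMap H (inclRight k A P) (f⁻¹).val) :=
  congrArg (· ∘ₗ δ.toLinearMap) (actR_comp_map (T ∘ₗ coactL δ f.val.ofConv) (f⁻¹).val.ofConv)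

lemma gaugeTwist_add (f : (WithConv (H →ₗ[k] P))ˣ) (T T' : P →ₗ[k] A ⊗[k] P) :
    gaugeTwist δ f (T + T') = gaugeTwist δ f T + gaugeTwist δ f T' := by
  simp only [gaugeTwist_eq_coactMul, LinearMap.add_comp, coactMul_add_left]

lemma rTensor_comp_gaugeTwist (L : M →ₗ[k] M') (f : (WithConv (H →ₗ[k] P))ˣ)
    (T : P →ₗ[k] M ⊗[k] P) :
    L.rTensor P ∘ₗ gaugeTwist δ f T = gaugeTwist δ f (L.rTensor P ∘ₗ T) := by
  have h : L.rTensor P ∘ₗ actR k P M = actR k P M' ∘ₗ (L.rTensor P).rTensor P := by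
    ext m p q
    simp [actR]
  rw [gaugeTwist, ← LinearMap.comp_assoc, h, LinearMap.comp_assoc,
    ← LinearMap.comp_assoc _ _ ((L.rTensor P).rTensor P), LinearMap.rTensor_comp_map]
  rfl

end ActionFormulas

section GaugeTwist

variable {δ : P →ₐ[k] P ⊗[k] H} {f g : (WithConv (H →ₗ[k] P))ˣ}

lemma IsGauge.isColinear_coactL (hδ : IsCoaction δ) (hf : IsGauge δ f) :
    IsColinear δ.toLinearMap δ.toLinearMap (coactL δ f.val.ofConv) := by
  rw [coactL_self]
  exact isColinear_id.coactMul hδ (fun p h ↦ map_mul δ p (f.val.ofConv h)) hf.colinear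

lemma coactMul_coactL_inv (hδ : IsCoaction δ) (f : (WithConv (H →ₗ[k] P))ˣ) :
    coactMul δ (coactL δ f.val.ofConv) (f⁻¹).val = LinearMap.id := by
  rw [coactL_self, coactMul_coactMul hδ, toConv_ofConv, Units.mul_inv, coactMul_one hδ]

lemma IsGauge.coactL_comp_coactL (hδ : IsCoaction δ) (hf : IsGauge δ f) :
    coactL δ g.val.ofConv ∘ₗ coactL δ f.val.ofConv = coactL δ (f * g).val.ofConv := by
  rw [coactL_self g.val.ofConv, coactMul_comp (hf.isColinear_coactL hδ), LinearMap.id_comp,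
    coactL_self, coactMul_coactMul hδ, coactL_self]
  rfl

lemma gaugeTwist_one (hδ : IsCoaction δ) (T : P →ₗ[k] A ⊗[k] P) : gaugeTwist δ 1 T = T := by
  rw [gaugeTwist_eq_coactMul, coactL_self, Units.val_one, toConv_ofConv, coactMul_one hδ, inv_one,
    Units.val_one, map_one, coactMul_one hδ, LinearMap.comp_id]

lemma IsGauge.gaugeTwist_mul (hδ : IsCoaction δ) (hf : IsGauge δ f) (T : P →ₗ[k] A ⊗[k] P) :
    gaugeTwist δ (f * g) T = gaugeTwist δ f (gaugeTwist δ g T) := by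
  simp only [gaugeTwist_eq_coactMul]
  rw [coactMul_comp (hf.isColinear_coactL hδ), LinearMap.comp_assoc, hf.coactL_comp_coactL hδ,
    coactMul_coactMul hδ, ← map_mul, mul_inv_rev, Units.val_mul,
    Units.val_mul]

lemma gaugeTwist_inclRight (hδ : IsCoaction δ) (f : (WithConv (H →ₗ[k] P))ˣ) :
    gaugeTwist δ f (inclRight k A P).toLinearMap = (inclRight k A P).toLinearMap := by
  rw [gaugeTwist_eq_coactMul, ← algHom_comp_coactMul, coactMul_coactL_inv hδ, LinearMap.comp_id]

lemma gaugeTwist_apply_one (hf : IsGauge δ f) (T : P →ₗ[k] A ⊗[k] P) :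
    gaugeTwist δ f T 1 = T 1 := by
  rw [gaugeTwist_eq_coactMul, coactMul_apply_one, ofConv_convMap, LinearMap.comp_apply,
    LinearMap.comp_apply, coactL_apply_one, hf.map_one, hf.inv.map_one, AlgHom.toLinearMap_apply,
    map_one (inclRight k A P), mul_one]

lemma gaugeTwist_coinv_mul (T : P →ₗ[coinv δ] coinv δ ⊗[k] P) (b : coinv δ) (p : P) :
    gaugeTwist δ f (T.restrictScalars k) (b * p) = b • gaugeTwist δ f (T.restrictScalars k) p := by
  rw [gaugeTwist_eq_coactMul, coactMul_coinv_mul (a := b • 1), smul_one_mul]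
  intro q
  rw [smul_one_mul, LinearMap.comp_apply, LinearMap.comp_apply, coactL_coinv_mul, smul_eq_mul]
  exact T.map_smul b _

end GaugeTwist

section CoactionB

variable {δ : P →ₐ[k] P ⊗[k] H} {f : (WithConv (H →ₗ[k] P))ˣ}

lemma mulB_mul_inclRight (x : coinv δ ⊗[k] P) (q : P) :
    mulB δ (x * inclRight k (coinv δ) P q) = mulB δ x * q := by
  induction x with
  | zero => simp
  | add x y hx hy => simp only [add_mul, map_add, hx, hy]
  | tmul b p => simp [mulB, actL, Subalgebra.smul_def, mul_assoc]

lemma mulB_comp_gaugeTwist (hδ : IsCoaction δ) {T : P →ₗ[k] coinv δ ⊗[k] P}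
    (hT : mulB δ ∘ₗ T = LinearMap.id) : mulB δ ∘ₗ gaugeTwist δ f T = LinearMap.id := by
  rw [gaugeTwist_eq_coactMul, ← coactMul_coactL_inv hδ f]
  refine comp_coactMul fun p g ↦ ?_
  exact (mulB_mul_inclRight _ _).trans (congrArg (· * _) (LinearMap.congr_fun hT _))

lemma coactionB_mul (x y : coinv δ ⊗[k] P) :
    coactionB δ (x * y) = coactionB δ x * coactionB δ y := by
  have h : coactionB δ = ((Algebra.TensorProduct.assoc k k k (coinv δ) P H).symm.toAlgHom.comp
      (Algebra.TensorProduct.map (AlgHom.id k (coinv δ)) δ)).toLinearMap :=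
    TensorProduct.ext' fun _ _ ↦ rfl
  simp only [h, AlgHom.toLinearMap_apply, map_mul]

lemma isColinear_inclRight :
    IsColinear δ.toLinearMap (coactionB δ) (inclRight k (coinv δ) P).toLinearMap :=
  congrArg (· ∘ₗ δ.toLinearMap) (TensorProduct.ext' fun _ _ ↦ rfl :
    (TensorProduct.assoc k (coinv δ) P H).symm.toLinearMap ∘ₗ
      TensorProduct.mk k (coinv δ) (P ⊗[k] H) 1 = (inclRight k (coinv δ) P).toLinearMap.rTensor H)

lemma IsGauge.isColinear_gaugeTwist (hδ : IsCoaction δ) (hf : IsGauge δ f)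
    {T : P →ₗ[k] coinv δ ⊗[k] P} (hT : IsColinear δ.toLinearMap (coactionB δ) T) :
    IsColinear δ.toLinearMap (coactionB δ) (gaugeTwist δ f T) := by
  rw [gaugeTwist_eq_coactMul]
  exact (hT.comp (hf.isColinear_coactL hδ)).coactMul hδ (fun _ _ ↦ coactionB_mul _ _)
    (isColinear_inclRight.comp hf.inv.colinear)

end CoactionB

/-! ### Universal one-forms -/

section DiagCoaction

variable {δ : P →ₐ[k] P ⊗[k] H}

lemma diagCoaction_tmul (p q : P) : diagCoaction δ (p ⊗ₜ q) =
    Algebra.TensorProduct.map (inclLeft k P P) (AlgHom.id k H) (δ p) *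
      Algebra.TensorProduct.map (inclRight k P P) (AlgHom.id k H) (δ q) := by
  change (LinearMap.mul' k H).lTensor (P ⊗[k] P)
    (TensorProduct.tensorTensorTensorComm k P H P H (δ p ⊗ₜ δ q)) = _
  induction δ p with
  | zero => simp
  | add x y hx hy => simp only [TensorProduct.add_tmul, map_add, add_mul, hx, hy]
  | tmul a g =>
    induction δ q with
    | zero => simp
    | add x y hx hy => simp only [TensorProduct.tmul_add, map_add, mul_add, hx, hy]
    | tmul b h => simp

lemma diagCoaction_smul (r : P) (x : P ⊗[k] P) : diagCoaction δ (r • x) =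
    Algebra.TensorProduct.map (inclLeft k P P) (AlgHom.id k H) (δ r) * diagCoaction δ x := by
  induction x with
  | zero => simp
  | add x y hx hy => simp only [smul_add, map_add, mul_add, hx, hy]
  | tmul p q =>
    rw [TensorProduct.smul_tmul', smul_eq_mul, diagCoaction_tmul, diagCoaction_tmul, map_mul,
      map_mul, mul_assoc]

lemma diagCoaction_inclLeft (p : P) : diagCoaction δ (inclLeft k P P p) =
    Algebra.TensorProduct.map (inclLeft k P P) (AlgHom.id k H) (δ p) := by
  rw [Algebra.TensorProduct.includeLeft_apply, diagCoaction_tmul, map_one, map_one, mul_one]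

lemma diagCoaction_inclRight (p : P) : diagCoaction δ (inclRight k P P p) =
    Algebra.TensorProduct.map (inclRight k P P) (AlgHom.id k H) (δ p) := by
  rw [Algebra.TensorProduct.includeRight_apply, diagCoaction_tmul, map_one, map_one, one_mul]

lemma diagCoaction_inclLeft_mul (p : P) (x : P ⊗[k] P) :
    diagCoaction δ (inclLeft k P P p * x) =
      diagCoaction δ (inclLeft k P P p) * diagCoaction δ x := by
  rw [inclLeft_eq_smul_one, smul_one_mul, diagCoaction_smul, ← inclLeft_eq_smul_one,
    diagCoaction_inclLeft]

lemma isColinear_diag_inclLeft :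
    IsColinear δ.toLinearMap (diagCoaction δ) (inclLeft k P P).toLinearMap :=
  LinearMap.ext diagCoaction_inclLeft

lemma isColinear_diag_inclRight :
    IsColinear δ.toLinearMap (diagCoaction δ) (inclRight k P P).toLinearMap :=
  LinearMap.ext diagCoaction_inclRight

lemma IsColinear.extendLeft {N : P →ₗ[k] P ⊗[k] P}
    (hN : IsColinear δ.toLinearMap (diagCoaction δ) N) :
    IsColinear (diagCoaction δ) (diagCoaction δ) ((extendLeft N).restrictScalars k) := by
  refine TensorProduct.ext' fun p q ↦ ?_
  have hq : diagCoaction δ (N q) = N.rTensor H (δ q) := LinearMap.congr_fun hN q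
  simp only [LinearMap.comp_apply, LinearMap.restrictScalars_apply, extendLeft_tmul,
    diagCoaction_smul, hq, diagCoaction_tmul]
  induction δ p with
  | zero => simp
  | add x y hx hy => simp only [map_add, add_mul, hx, hy]
  | tmul a g =>
    induction δ q with
    | zero => simp
    | add x y hx hy => simp only [map_add, mul_add, hx, hy]
    | tmul b h => simp [extendLeft_tmul, TensorProduct.smul_tmul', ← smul_one_mul a (N b),
        Algebra.TensorProduct.one_def]

lemma isColinear_incl :
    IsColinear (omegaCoaction δ) (diagCoaction δ) (Omega.incl k P) :=
  LinearMap.ext fun x ↦ (incl_omegaCoaction δ x).symm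

lemma isColinear_inclB : IsColinear (coactionB δ) (diagCoaction δ) (inclB δ) := by
  refine TensorProduct.ext' fun b p ↦ ?_
  have hb : diagCoaction δ ((b : P) ⊗ₜ p) = (((b : P) ⊗ₜ 1) ⊗ₜ 1) *
      Algebra.TensorProduct.map (inclRight k P P) (AlgHom.id k H) (δ p) := by
    rw [diagCoaction_tmul, show δ b = (b : P) ⊗ₜ 1 from b.2]
    rfl
  have hp : (inclB δ).rTensor H ∘ₗ (TensorProduct.assoc k (coinv δ) P H).symm.toLinearMap ∘ₗ
      TensorProduct.mk k (coinv δ) (P ⊗[k] H) b =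
        LinearMap.mulLeft k (((b : P) ⊗ₜ[k] (1 : P)) ⊗ₜ[k] (1 : H)) ∘ₗ
          (Algebra.TensorProduct.map (inclRight k P P) (AlgHom.id k H)).toLinearMap :=
    TensorProduct.ext' fun q h ↦ by simp [inclB]
  exact hb.trans (LinearMap.congr_fun hp (δ p)).symm

end DiagCoaction

section UniversalCalculus

variable {M : Type*} [AddCommGroup M] [Module k M] [Module P M] [IsScalarTower k P M]

lemma Omega.incl_injective : Function.Injective (Omega.incl k P) := Subtype.val_injective

lemma Omega.coe_proj {x : P ⊗[k] P} (hx : LinearMap.mul' k P x = 0) :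
    (Omega.proj k P x : P ⊗[k] P) = x := by
  simp [Omega.proj, hx]

lemma Omega.proj_tmul (r p : P) : Omega.proj k P (r ⊗ₜ[k] p) = r • d k p := by
  ext
  simp [Omega.proj, coe_d, smul_sub, TensorProduct.smul_tmul']

lemma Omega.hom_ext {Q Q' : Omega k P →ₗ[P] M} (h : ∀ p, Q (d k p) = Q' (d k p)) : Q = Q' := by
  ext x
  rw [← Subtype.ext (Omega.coe_proj x.2)]
  refine LinearMap.congr_fun (TensorProduct.ext' fun r p ↦ ?_ :
    Q.restrictScalars k ∘ₗ Omega.proj k P = Q'.restrictScalars k ∘ₗ Omega.proj k P) x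
  simp only [LinearMap.comp_apply, LinearMap.restrictScalars_apply, Omega.proj_tmul, map_smul, h]

lemma incl_comp_d : Omega.incl k P ∘ₗ d k =
    (inclRight k P P).toLinearMap - (inclLeft k P P).toLinearMap :=
  LinearMap.ext coe_d

lemma d_one : d k (1 : P) = 0 := by
  ext
  simp [coe_d]

lemma extendLeft_coe_d {E : P →ₗ[k] M} (hE : E 1 = 0) (p : P) :
    extendLeft E (d k p : P ⊗[k] P) = E p := by
  rw [coe_d, map_sub, extendLeft_tmul, extendLeft_tmul, hE, one_smul, smul_zero, sub_zero]

variable {δ : P →ₐ[k] P ⊗[k] H}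

lemma isColinear_d : IsColinear δ.toLinearMap (omegaCoaction δ) (d k) := by
  rw [← isColinear_incl.comp_iff Omega.incl_injective, incl_comp_d]
  exact isColinear_diag_inclRight.sub isColinear_diag_inclLeft

end UniversalCalculus

section HorizontalForms

variable {δ : P →ₐ[k] P ⊗[k] H}

lemma inclB_injective : Function.Injective (inclB δ) :=
  Module.Flat.rTensor_preserves_injective_linearMap _ Subtype.val_injective

lemma inclB_smul (b : coinv δ) (x : coinv δ ⊗[k] P) : inclB δ (b • x) = (b : P) • inclB δ x := by
  induction x with
  | zero => simp
  | add x y hx hy => simp only [map_add, smul_add, hx, hy]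
  | tmul c p => simp [inclB, TensorProduct.smul_tmul']

lemma mulB_smul (b : coinv δ) (x : coinv δ ⊗[k] P) : mulB δ (b • x) = b • mulB δ x := by
  induction x with
  | zero => simp
  | add x y hx hy => simp only [map_add, smul_add, hx, hy]
  | tmul c p => simp [mulB, actL, TensorProduct.smul_tmul']

lemma mulB_one_tmul (p : P) : mulB δ (1 ⊗ₜ p) = p := by
  simp [mulB, actL]

lemma mul_inclB (x : coinv δ ⊗[k] P) : LinearMap.mul' k P (inclB δ x) = mulB δ x :=
  LinearMap.congr_fun (TensorProduct.ext' fun _ _ ↦ rfl :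
    LinearMap.mul' k P ∘ₗ inclB δ = mulB δ) x

lemma extendLeft_inclB {M : Type*} [AddCommGroup M] [Module k M] [Module P M]
    [IsScalarTower k P M] {E : P →ₗ[k] M} (hE : ∀ (b : coinv δ) p, E (b * p) = (b : P) • E p)
    (x : coinv δ ⊗[k] P) : extendLeft E (inclB δ x) = E (mulB δ x) :=
  LinearMap.congr_fun (TensorProduct.ext' fun b p ↦ (hE b p).symm :
    (extendLeft E).restrictScalars k ∘ₗ inclB δ = E ∘ₗ mulB δ) x

lemma preCan_inclB (x : coinv δ ⊗[k] P) : preCan δ (inclB δ x) = δ (mulB δ x) := by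
  rw [preCan_eq_extendLeft, extendLeft_inclB coaction_coinv_mul, AlgHom.toLinearMap_apply]

lemma proj_inclB_mem_BdP (x : coinv δ ⊗[k] P) : Omega.proj k P (inclB δ x) ∈ BdP δ := by
  induction x with
  | zero => simp
  | add x y hx hy => simpa only [map_add] using add_mem hx hy
  | tmul b p => exact Submodule.subset_span ⟨b, p, Omega.proj_tmul (b : P) p⟩

lemma d_mem_BdP (p : P) : d k p ∈ BdP δ :=
  Submodule.subset_span ⟨1, p, (one_smul P (d k p)).symm⟩

lemma smul_mem_OmegaBP (b : coinv δ) {x : P ⊗[k] P} (hx : x ∈ OmegaBP δ) :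
    (b : P) • x ∈ OmegaBP δ := by
  obtain ⟨y, hy, rfl⟩ := hx
  have hy : mulB δ y = 0 := hy
  exact ⟨b • y, (mulB_smul b y).trans (by rw [hy, smul_zero]), inclB_smul b y⟩

lemma leibniz_mem_OmegaB (b : coinv δ) (p : P) :
    1 ⊗ₜ[k] ((b : P) * p) - b ⊗ₜ[k] p ∈ OmegaB δ := by
  change mulB δ _ = 0
  simp [mulB, actL, Subalgebra.smul_def]

lemma coe_d_coinv_mul (b : coinv δ) (p : P) : (d k ((b : P) * p) : P ⊗[k] P) =
    (b : P) • (d k p : P ⊗[k] P) + inclB δ (1 ⊗ₜ[k] ((b : P) * p) - b ⊗ₜ[k] p) := by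
  simp only [coe_d, inclB, map_sub, LinearMap.rTensor_tmul, AlgHom.toLinearMap_apply, map_one,
    Subalgebra.coe_val, smul_sub, TensorProduct.smul_tmul', smul_eq_mul, mul_one]
  abel

end HorizontalForms

/-! ### Differentials, connections and connection forms -/

section DifferentialEquiv

variable {δ : P →ₐ[k] P ⊗[k] H}

/-- The splitting `s p = 1 ⊗ p - D p`. -/
def CovariantDifferential.splitting (D : CovariantDifferential δ) :
    P →ₗ[coinv δ] coinv δ ⊗[k] P where
  toFun p := 1 ⊗ₜ p - D.toMap p
  map_add' p q := by rw [TensorProduct.tmul_add, map_add, add_sub_add_comm]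
  map_smul' b p := by
    rw [Subalgebra.smul_def, smul_eq_mul, D.leibniz, RingHom.id_apply, smul_sub,
      TensorProduct.smul_tmul', smul_eq_mul, mul_one]
    abel

lemma CovariantDifferential.splitting_apply (D : CovariantDifferential δ) (p : P) :
    D.splitting p = 1 ⊗ₜ p - D.toMap p := rfl

lemma CovariantDifferential.isColinear_splitting (D : CovariantDifferential δ) :
    IsColinear δ.toLinearMap (coactionB δ) (D.splitting.restrictScalars k) := by
  have h : D.splitting.restrictScalars k = (inclRight k (coinv δ) P).toLinearMap - D.toMap := rfl
  rw [h]
  exact isColinear_inclRight.sub D.colinear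

/-- Covariant differentials correspond to splittings by `D p = 1 ⊗ p - s p`. -/
def splittingEquivDifferential (δ : P →ₐ[k] P ⊗[k] H) :
    StrongSplitting δ ≃ CovariantDifferential δ where
  toFun s :=
    { toMap := (inclRight k (coinv δ) P).toLinearMap - s.toMap.restrictScalars k
      mem := fun p ↦ by
        change mulB δ (1 ⊗ₜ p - s.toMap p) = 0
        simp [mulB_one_tmul, s.splits]
      map_one := by simp [s.map_one]
      leibniz := fun b p ↦ by
        have h : s.toMap (b * p) = b • s.toMap p := s.toMap.map_smul b p
        simp [h, smul_sub, TensorProduct.smul_tmul']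
      colinear := isColinear_inclRight.sub s.colinear }
  invFun D :=
    { toMap := D.splitting
      map_one := by simp [D.splitting_apply, D.map_one]
      splits := fun p ↦ by
        have h : mulB δ (D.toMap p) = 0 := D.mem p
        rw [D.splitting_apply, map_sub, mulB_one_tmul, h, sub_zero]
      colinear := D.isColinear_splitting }
  left_inv s := StrongSplitting.ext <| LinearMap.ext fun p ↦ sub_sub_cancel (1 ⊗ₜ p) (s.toMap p)
  right_inv D :=
    CovariantDifferential.ext <| LinearMap.ext fun p ↦ sub_sub_cancel (1 ⊗ₜ p) (D.toMap p)

/-- The vertical part of the universal differential under a strong connection: the map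
`dp ↦ dp - Dp = Π(dp) = p₍₀₎ ω(p₍₁₎)` through which `D`, `Π` and `ω` determine one another. -/
@[ext]
structure VerticalDifferential (δ : P →ₐ[k] P ⊗[k] H) where
  toMap : P →ₗ[k] Omega k P
  map_one : toMap 1 = 0
  map_coinv_mul : ∀ (b : coinv δ) (p : P), toMap (b * p) = (b : P) • toMap p
  colinear : IsColinear δ.toLinearMap (omegaCoaction δ) toMap
  strong : ∀ p, (d k p - toMap p : P ⊗[k] P) ∈ OmegaBP δ

lemma coe_proj_inclB {x : coinv δ ⊗[k] P} (hx : x ∈ OmegaB δ) :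
    (Omega.proj k P (inclB δ x) : P ⊗[k] P) = inclB δ x :=
  Omega.coe_proj ((mul_inclB x).trans hx)

/-- `dp - Dp` as an element of `Ω¹P`. -/
def CovariantDifferential.vertical (D : CovariantDifferential δ) : P →ₗ[k] Omega k P :=
  d k - Omega.proj k P ∘ₗ inclB δ ∘ₗ D.toMap

lemma CovariantDifferential.coe_vertical (D : CovariantDifferential δ) (p : P) :
    (D.vertical p : P ⊗[k] P) = d k p - inclB δ (D.toMap p) :=
  congrArg ((d k p : P ⊗[k] P) - ·) (coe_proj_inclB (D.mem p))

/-- The map `p ↦ dp - N p`, with values in `B ⊗ P`. -/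
def VerticalDifferential.horizontal (N : VerticalDifferential δ) : P →ₗ[k] coinv δ ⊗[k] P :=
  (OmegaB δ).subtype ∘ₗ
    (Submodule.equivMapOfInjective (inclB δ) inclB_injective (OmegaB δ)).symm.toLinearMap ∘ₗ
      LinearMap.codRestrict (OmegaBP δ) (Omega.incl k P ∘ₗ (d k - N.toMap)) N.strong

lemma VerticalDifferential.horizontal_mem (N : VerticalDifferential δ) (p : P) :
    N.horizontal p ∈ OmegaB δ := Subtype.coe_prop _

lemma VerticalDifferential.inclB_horizontal (N : VerticalDifferential δ) (p : P) :
    inclB δ (N.horizontal p) = d k p - N.toMap p := by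
  have h := (Submodule.equivMapOfInjective (inclB δ) inclB_injective (OmegaB δ)).apply_symm_apply
    (LinearMap.codRestrict (OmegaBP δ) (Omega.incl k P ∘ₗ (d k - N.toMap)) N.strong p)
  exact congrArg Subtype.val h

/-- Covariant differentials correspond to vertical differentials by `N p = dp - D p`. -/
def differentialEquivVertical (δ : P →ₐ[k] P ⊗[k] H) :
    CovariantDifferential δ ≃ VerticalDifferential δ where
  toFun D :=
    { toMap := D.vertical
      map_one := by simp [CovariantDifferential.vertical, d_one, D.map_one]
      map_coinv_mul := fun b p ↦ by
        ext
        rw [Submodule.coe_smul, D.coe_vertical, D.coe_vertical, D.leibniz, coe_d_coinv_mul, map_add,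
          inclB_smul, smul_sub]
        abel
      colinear := by
        refine (isColinear_incl.comp_iff Omega.incl_injective).1 ?_
        have h : Omega.incl k P ∘ₗ D.vertical = Omega.incl k P ∘ₗ d k - inclB δ ∘ₗ D.toMap :=
          LinearMap.ext D.coe_vertical
        rw [h]
        exact (isColinear_incl.comp isColinear_d).sub (isColinear_inclB.comp D.colinear)
      strong := fun p ↦ by
        rw [D.coe_vertical, sub_sub_cancel]
        exact Submodule.mem_map_of_mem (D.mem p) }
  invFun N :=
    { toMap := N.horizontal
      mem := N.horizontal_mem
      map_one := inclB_injective (by simp [N.inclB_horizontal, d_one, N.map_one])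
      leibniz := fun b p ↦ inclB_injective <| by
        rw [map_add, inclB_smul, N.inclB_horizontal, N.inclB_horizontal, N.map_coinv_mul,
          coe_d_coinv_mul, Submodule.coe_smul, smul_sub]
        abel
      colinear := by
        refine (isColinear_inclB.comp_iff inclB_injective).1 ?_
        have h : inclB δ ∘ₗ N.horizontal = Omega.incl k P ∘ₗ (d k - N.toMap) :=
          LinearMap.ext N.inclB_horizontal
        rw [h]
        exact isColinear_incl.comp (isColinear_d.sub N.colinear) }
  left_inv D := CovariantDifferential.ext <| LinearMap.ext fun p ↦ inclB_injective <| by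
    rw [VerticalDifferential.inclB_horizontal, D.coe_vertical, sub_sub_cancel]
  right_inv N := VerticalDifferential.ext <| LinearMap.ext fun p ↦ Subtype.ext <| by
    rw [CovariantDifferential.coe_vertical, N.inclB_horizontal, sub_sub_cancel]

end DifferentialEquiv

section ConnectionEquiv

variable {δ : P →ₐ[k] P ⊗[k] H}

/-- The left `P`-linear map `r dp ↦ r N p` on `Ω¹P`. -/
def VerticalDifferential.connection (N : VerticalDifferential δ) : Omega k P →ₗ[P] Omega k P :=
  extendLeft N.toMap ∘ₗ (Omega k P).subtype

lemma VerticalDifferential.connection_d (N : VerticalDifferential δ) (p : P) :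
    N.connection (d k p) = N.toMap p := extendLeft_coe_d N.map_one p

lemma VerticalDifferential.connection_eq_zero (N : VerticalDifferential δ) {x : Omega k P}
    (hx : (x : P ⊗[k] P) ∈ OmegaBP δ) : N.connection x = 0 := by
  obtain ⟨y, hy, hyx⟩ := hx
  have hy : mulB δ y = 0 := hy
  calc N.connection x = extendLeft N.toMap (inclB δ y) := by rw [hyx]; rfl
    _ = 0 := by rw [extendLeft_inclB N.map_coinv_mul, hy, map_zero]

lemma VerticalDifferential.connection_idem (N : VerticalDifferential δ) (x : Omega k P) :
    N.connection (N.connection x) = N.connection x := by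
  refine LinearMap.congr_fun (Omega.hom_ext fun p ↦ ?_ :
    N.connection ∘ₗ N.connection = N.connection) x
  have h : N.connection (d k p - N.toMap p) = 0 := N.connection_eq_zero (N.strong p)
  rw [LinearMap.comp_apply, N.connection_d]
  rw [map_sub, N.connection_d, sub_eq_zero] at h
  exact h.symm

lemma VerticalDifferential.isColinear_connection (N : VerticalDifferential δ) :
    IsColinear (omegaCoaction δ) (omegaCoaction δ) (N.connection.restrictScalars k) := by
  refine (isColinear_incl.comp_iff Omega.incl_injective).1 ?_
  have h : Omega.incl k P ∘ₗ N.connection.restrictScalars k =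
      (extendLeft (Omega.incl k P ∘ₗ N.toMap)).restrictScalars k ∘ₗ Omega.incl k P :=
    LinearMap.ext fun x ↦ map_extendLeft (Omega k P).subtype N.toMap x
  rw [h]
  exact (isColinear_incl.comp N.colinear).extendLeft.comp isColinear_incl

lemma VerticalDifferential.map_BdP (N : VerticalDifferential δ) :
    (BdP δ).map (Omega.incl k P ∘ₗ (LinearMap.id - N.connection.restrictScalars k)) =
      OmegaBP δ := by
  apply le_antisymm
  · rw [Submodule.map_le_iff_le_comap, BdP, Submodule.span_le]
    rintro _ ⟨b, p, rfl⟩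
    have h : (Omega.incl k P ∘ₗ (LinearMap.id - N.connection.restrictScalars k)) ((b : P) • d k p) =
        (b : P) • (d k p - N.toMap p : P ⊗[k] P) := by
      rw [← N.connection_d, smul_sub, ← Submodule.coe_smul, ← Submodule.coe_smul,
        ← map_smul N.connection]
      rfl
    rw [SetLike.mem_coe, Submodule.mem_comap, h]
    exact smul_mem_OmegaBP b (N.strong p)
  · rintro _ ⟨y, hy, rfl⟩
    refine ⟨Omega.proj k P (inclB δ y), proj_inclB_mem_BdP y, ?_⟩
    have h : N.connection (Omega.proj k P (inclB δ y)) = 0 :=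
      N.connection_eq_zero ((coe_proj_inclB hy).symm ▸ Submodule.mem_map_of_mem hy)
    calc (Omega.proj k P (inclB δ y) - N.connection (Omega.proj k P (inclB δ y)) : P ⊗[k] P)
        = inclB δ y := by rw [h, coe_proj_inclB hy, ZeroMemClass.coe_zero, sub_zero]

lemma StrongConnection.map_eq_zero (Q : StrongConnection δ) {x : Omega k P}
    (hx : (x : P ⊗[k] P) ∈ OmegaBP δ) : Q.toMap x = 0 := by
  rw [← Q.strong] at hx
  obtain ⟨y, -, hy⟩ := hx
  have hxy : y - Q.toMap y = x := Omega.incl_injective hy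
  rw [← hxy, map_sub, Q.idem, sub_self]

lemma StrongConnection.map_d_coinv_mul (Q : StrongConnection δ) (b : coinv δ) (p : P) :
    Q.toMap (d k (b * p)) = (b : P) • Q.toMap (d k p) := by
  rw [← map_smul, ← sub_eq_zero, ← map_sub]
  refine Q.map_eq_zero ?_
  rw [Submodule.coe_sub, Submodule.coe_smul, coe_d_coinv_mul, add_sub_cancel_left]
  exact Submodule.mem_map_of_mem (leibniz_mem_OmegaB b p)

/-- Vertical differentials correspond to connections by `N p = Π(dp)`. -/
def verticalEquivConnection (δ : P →ₐ[k] P ⊗[k] H) :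
    VerticalDifferential δ ≃ StrongConnection δ where
  toFun N :=
    { toMap := N.connection
      idem := N.connection_idem
      colinear := N.isColinear_connection
      strong := N.map_BdP }
  invFun Q :=
    { toMap := Q.toMap.restrictScalars k ∘ₗ d k
      map_one := by rw [LinearMap.comp_apply, d_one, map_zero]
      map_coinv_mul := Q.map_d_coinv_mul
      colinear := IsColinear.comp Q.colinear isColinear_d
      strong := fun p ↦ by
        rw [← Q.strong]
        exact Submodule.mem_map_of_mem (d_mem_BdP p) }
  left_inv N := VerticalDifferential.ext <| LinearMap.ext N.connection_d
  right_inv Q := StrongConnection.ext <| Omega.hom_ext <| VerticalDifferential.connection_d _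

end ConnectionEquiv

section Galois

variable {δ : P →ₐ[k] P ⊗[k] H} {M : Type*} [AddCommGroup M] [Module k M] [Module P M]
  [IsScalarTower k P M]

lemma preCan_surjective (hδ : IsHopfGalois δ) : Function.Surjective (preCan δ) :=
  hδ.bijective_can.2.comp (balancing δ).mkQ_surjective

lemma ker_preCan (hδ : IsHopfGalois δ) : LinearMap.ker (preCan δ) = balancing δ := by
  refine le_antisymm (fun x hx ↦ ?_) (balancing_le_ker δ)
  rw [← (balancing δ).ker_mkQ, LinearMap.mem_ker, ← (can δ).map_eq_zero_iff hδ.bijective_can.1]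
  exact hx

lemma preCan_eq_of_mkQ_eq_translation (hδ : IsHopfGalois δ) {t : P ⊗[k] P} {h : H}
    (ht : (balancing δ).mkQ t = translation hδ h) : preCan δ t = 1 ⊗ₜ h := by
  change can δ ((balancing δ).mkQ t) = _
  rw [ht]
  exact (LinearEquiv.ofBijective (can δ) hδ.bijective_can).apply_symm_apply _

lemma balancing_le_ker_extendLeft {N : P →ₗ[k] M}
    (hN : ∀ (b : coinv δ) p, N (b * p) = (b : P) • N p) :
    balancing δ ≤ LinearMap.ker ((extendLeft N).restrictScalars k) := by
  rw [balancing, Submodule.span_le]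
  rintro _ ⟨p, q, b, rfl⟩
  rw [SetLike.mem_coe, LinearMap.mem_ker, LinearMap.restrictScalars_apply, map_sub,
    extendLeft_tmul, extendLeft_tmul, hN, mul_smul, sub_self]

lemma coactL_injective (hδ : IsHopfGalois δ) :
    Function.Injective (coactL δ : (H →ₗ[k] M) → P →ₗ[k] M) := by
  intro T U hTU
  ext h
  obtain ⟨t, ht⟩ := preCan_surjective hδ (1 ⊗ₜ h)
  have key (X : H →ₗ[k] M) : X h = extendLeft (coactL δ X) t := by
    rw [extendLeft_coactL, ht, extendLeft_tmul, one_smul]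
  rw [key, key, hTU]

lemma exists_coactL_eq (hδ : IsHopfGalois δ) {N : P →ₗ[k] M}
    (hN : ∀ (b : coinv δ) p, N (b * p) = (b : P) • N p) : ∃ T : H →ₗ[k] M, coactL δ T = N := by
  let χ : P ⊗[k] P →ₗ[P] P ⊗[k] H := extendLeft δ.toLinearMap
  have hχ (x) : χ x = preCan δ x := (preCan_eq_extendLeft x).symm
  have hsurj : Function.Surjective χ :=
    fun x ↦ (preCan_surjective hδ x).imp fun t ht ↦ (hχ t).trans ht
  have hker : LinearMap.ker χ ≤ LinearMap.ker (extendLeft N) := fun x hx ↦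
    balancing_le_ker_extendLeft hN (ker_preCan hδ ▸ (hχ x).symm.trans hx)
  let E : P ⊗[k] H →ₗ[P] M :=
    (LinearMap.ker χ).liftQ (extendLeft N) hker ∘ₗ (χ.quotKerEquivOfSurjective hsurj).symm
  have hE (x) : E (χ x) = extendLeft N x :=
    congrArg ((LinearMap.ker χ).liftQ (extendLeft N) hker)
      (χ.quotKerEquivOfSurjective_symm_apply hsurj x)
  let T : H →ₗ[k] M := E.restrictScalars k ∘ₗ TensorProduct.mk k P H 1
  have hT : extendLeft T = E := TensorProduct.AlgebraTensorModule.ext fun p h ↦ by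
    rw [extendLeft_tmul, LinearMap.comp_apply, LinearMap.restrictScalars_apply, ← map_smul,
      TensorProduct.mk_apply, TensorProduct.smul_tmul', smul_eq_mul, mul_one]
  refine ⟨T, LinearMap.ext fun p ↦ ?_⟩
  calc coactL δ T p = E (δ p) := by rw [coactL_apply, hT]
    _ = E (χ (1 ⊗ₜ p)) := by rw [extendLeft_tmul, one_smul, AlgHom.toLinearMap_apply]
    _ = N p := by rw [hE, extendLeft_tmul, one_smul]

lemma isColinear_coactL_iff (hδ : IsHopfGalois δ) {T : H →ₗ[k] P ⊗[k] P} :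
    IsColinear δ.toLinearMap (diagCoaction δ) (coactL δ T) ↔
      IsColinear (adCoaction k H) (diagCoaction δ) T := by
  let i : P →ₐ[k] (P ⊗[k] P) ⊗[k] H := (inclLeft k (P ⊗[k] P) H).comp (inclLeft k P P)
  have hi (r : P) : i r = r • 1 := by
    simp [i, Algebra.TensorProduct.one_def, TensorProduct.smul_tmul']
  have hinj (X Y : WithConv (H →ₗ[k] (P ⊗[k] P) ⊗[k] H)) :
      coactMul δ i.toLinearMap X = coactMul δ i.toLinearMap Y ↔ X = Y := by
    rw [← toConv_ofConv X, ← toConv_ofConv Y, ← coactL_eq_coactMul hi, ← coactL_eq_coactMul hi,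
      (coactL_injective hδ).eq_iff, toConv_injective.eq_iff]
  rw [coactL_eq_coactMul inclLeft_eq_smul_one,
    isColinear_coactMul_iff hδ.toIsCoaction (fun p h ↦ diagCoaction_inclLeft_mul p (T h))
      isColinear_diag_inclLeft, isColinear_adCoaction_iff]
  exact hinj _ _

lemma coactL_convUnit_sub_one (hδ : IsCoaction δ) :
    coactL δ ((convUnit k H P).val - 1).ofConv =
      δ.toLinearMap - (inclLeft k P H).toLinearMap := by
  rw [coactL_eq_coactMul inclLeft_eq_smul_one, toConv_ofConv, eq_sub_iff_add_eq]
  nth_rw 2 [← coactMul_one hδ (inclLeft k P H).toLinearMap]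
  rw [← coactMul_add_right, sub_add_cancel]
  simpa using (rTensor_comp_coaction (δ := δ) (LinearMap.id : P →ₗ[k] P)).symm

end Galois

section FormEquiv

variable {δ : P →ₐ[k] P ⊗[k] H}

lemma incl_comp_coactL (T : H →ₗ[k] Omega k P) :
    Omega.incl k P ∘ₗ coactL δ T = coactL δ (Omega.incl k P ∘ₗ T) :=
  comp_coactL (Omega k P).subtype T

lemma isColinear_coactL_omega_iff (hδ : IsHopfGalois δ) {T : H →ₗ[k] Omega k P} :
    IsColinear δ.toLinearMap (omegaCoaction δ) (coactL δ T) ↔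
      IsColinear (adCoaction k H) (omegaCoaction δ) T := by
  rw [← isColinear_incl.comp_iff Omega.incl_injective, incl_comp_coactL,
    isColinear_coactL_iff hδ, isColinear_incl.comp_iff Omega.incl_injective]

lemma VerticalDifferential.preCan_toMap (N : VerticalDifferential δ) (p : P) :
    preCan δ (N.toMap p) = δ p - p ⊗ₜ 1 := by
  obtain ⟨y, hy, hyp⟩ := N.strong p
  have hy : mulB δ y = 0 := hy
  have hN : (N.toMap p : P ⊗[k] P) = d k p - inclB δ y := by rw [hyp, sub_sub_cancel]
  rw [hN, map_sub, preCan_inclB, hy, map_zero, sub_zero, preCan_eq_extendLeft, coe_d, map_sub,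
    extendLeft_tmul, extendLeft_tmul, one_smul, AlgHom.toLinearMap_apply,
    AlgHom.toLinearMap_apply, _root_.map_one, ← inclLeft_eq_smul_one]
  rfl

lemma VerticalDifferential.preCan_form (hδ : IsHopfGalois δ) {N : VerticalDifferential δ}
    {T : H →ₗ[k] Omega k P} (hT : coactL δ T = N.toMap) (h : H) :
    preCan δ (T h) = 1 ⊗ₜ (h - algebraMap k H (Coalgebra.counit h)) := by
  let χ : Omega k P →ₗ[P] P ⊗[k] H := extendLeft δ.toLinearMap ∘ₗ (Omega k P).subtype
  have hχ (x : Omega k P) : χ x = preCan δ x := (preCan_eq_extendLeft _).symm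
  have key : χ.restrictScalars k ∘ₗ T = ((convUnit k H P).val - 1).ofConv := by
    apply coactL_injective hδ
    rw [← comp_coactL, hT, coactL_convUnit_sub_one hδ.toIsCoaction]
    exact LinearMap.ext fun p ↦ (hχ _).trans (N.preCan_toMap p)
  calc preCan δ (T h) = ((convUnit k H P).val - 1).ofConv h :=
        (hχ _).symm.trans (LinearMap.congr_fun key h)
    _ = 1 ⊗ₜ (h - algebraMap k H (Coalgebra.counit h)) := by
        change 1 ⊗ₜ h - algebraMap k (P ⊗[k] H) (Coalgebra.counit h) = _
        rw [TensorProduct.tmul_sub, Algebra.TensorProduct.algebraMap_apply']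

/-- The vertical differential `p ↦ p₍₀₎ ω(p₍₁₎)`. -/
def StrongConnectionForm.verticalDifferential (hδ : IsHopfGalois δ) (w : StrongConnectionForm δ) :
    VerticalDifferential δ where
  toMap := coactL δ w.toMap
  map_one := by rw [coactL_apply_one, w.map_one]
  map_coinv_mul := coactL_coinv_mul w.toMap
  colinear := (isColinear_coactL_omega_iff hδ).2 w.colinear
  strong := w.strong

/-- The form `ω` with `N p = p₍₀₎ ω(p₍₁₎)`. -/
def VerticalDifferential.form (hδ : IsHopfGalois δ) (N : VerticalDifferential δ) :
    StrongConnectionForm δ :=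
  have h := exists_coactL_eq hδ N.map_coinv_mul
  { toMap := h.choose
    map_one := by rw [← coactL_apply_one (δ := δ), h.choose_spec, N.map_one]
    colinear := (isColinear_coactL_omega_iff hδ).1 (h.choose_spec.symm ▸ N.colinear)
    vertical := VerticalDifferential.preCan_form hδ h.choose_spec
    strong := h.choose_spec.symm ▸ N.strong }

lemma VerticalDifferential.coactL_form (hδ : IsHopfGalois δ) (N : VerticalDifferential δ) :
    coactL δ (N.form hδ).toMap = N.toMap :=
  (exists_coactL_eq hδ N.map_coinv_mul).choose_spec

/-- Connection forms correspond to vertical differentials by `N p = p₍₀₎ ω(p₍₁₎)`. -/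
def formEquivVertical (hδ : IsHopfGalois δ) :
    StrongConnectionForm δ ≃ VerticalDifferential δ where
  toFun := StrongConnectionForm.verticalDifferential hδ
  invFun := VerticalDifferential.form hδ
  left_inv w := StrongConnectionForm.ext <| coactL_injective hδ <|
    (w.verticalDifferential hδ).coactL_form hδ
  right_inv N := VerticalDifferential.ext <| N.coactL_form hδ

end FormEquiv

section Identifications

variable {δ : P →ₐ[k] P ⊗[k] H}

/-- Connections correspond to covariant differentials by `Π(r dp) = r (dp - Dp)`. -/
def differentialEquivConnection (δ : P →ₐ[k] P ⊗[k] H) :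
    CovariantDifferential δ ≃ StrongConnection δ :=
  (differentialEquivVertical δ).trans (verticalEquivConnection δ)

/-- Connection forms correspond to connections by `ω(h) = h⁽¹⁾ Π(dh⁽²⁾)`. -/
def connectionEquivForm (hδ : IsHopfGalois δ) : StrongConnection δ ≃ StrongConnectionForm δ :=
  (verticalEquivConnection δ).symm.trans (formEquivVertical hδ).symm

/-- Splittings correspond to vertical differentials by `s p = p ⊗ 1 + N p`. -/
def splittingEquivVertical (δ : P →ₐ[k] P ⊗[k] H) : StrongSplitting δ ≃ VerticalDifferential δ :=
  (splittingEquivDifferential δ).trans (differentialEquivVertical δ)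

/-- Splittings correspond to connection forms by `s p = p ⊗ 1 + p₍₀₎ ω(p₍₁₎)`. -/
def formEquivSplitting (hδ : IsHopfGalois δ) : StrongConnectionForm δ ≃ StrongSplitting δ :=
  (formEquivVertical hδ).trans (splittingEquivVertical δ).symm

lemma differentialEquivConnection_smul_d (D : CovariantDifferential δ) (r p : P) :
    ((differentialEquivConnection δ D).toMap (r • d k p) : P ⊗[k] P) =
      r • (d k p - inclB δ (D.toMap p)) := by
  rw [map_smul, Submodule.coe_smul, ← D.coe_vertical]
  exact congrArg (fun x : Omega k P ↦ r • (x : P ⊗[k] P))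
    ((differentialEquivVertical δ D).connection_d p)

lemma connectionEquivForm_apply (hδ : IsHopfGalois δ) (Q : StrongConnection δ) {h : H}
    {t : P ⊗[k] P} (ht : (balancing δ).mkQ t = translation hδ h) :
    (connectionEquivForm hδ Q).toMap h =
      actL k P (Omega k P) ((Q.toMap.restrictScalars k ∘ₗ d k).lTensor P t) := by
  have hω : coactL δ (connectionEquivForm hδ Q).toMap = Q.toMap.restrictScalars k ∘ₗ d k :=
    ((verticalEquivConnection δ).symm Q).coactL_form hδ
  rw [← extendLeft_eq_actL, ← hω, extendLeft_coactL, preCan_eq_of_mkQ_eq_translation hδ ht,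
    extendLeft_tmul, one_smul]

lemma inclB_comp_splitting (s : StrongSplitting δ) :
    inclB δ ∘ₗ s.toMap.restrictScalars k =
      Omega.incl k P ∘ₗ (splittingEquivVertical δ s).toMap + (inclLeft k P P).toLinearMap := by
  ext p
  have h : ((splittingEquivVertical δ s).toMap p : P ⊗[k] P) =
      d k p - inclB δ (1 ⊗ₜ p - s.toMap p) :=
    (splittingEquivDifferential δ s).coe_vertical p
  have h1 : inclB δ (1 ⊗ₜ p) = 1 ⊗ₜ p := rfl
  change inclB δ (s.toMap p) = ((splittingEquivVertical δ s).toMap p : P ⊗[k] P) + p ⊗ₜ[k] 1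
  rw [h, coe_d, map_sub, h1]
  abel

lemma inclB_formEquivSplitting (hδ : IsHopfGalois δ) (w : StrongConnectionForm δ) (p : P) :
    inclB δ ((formEquivSplitting hδ w).toMap p) = p ⊗ₜ 1 + (coactL δ w.toMap p : P ⊗[k] P) := by
  have h := LinearMap.congr_fun (inclB_comp_splitting (formEquivSplitting hδ w)) p
  rw [formEquivSplitting, Equiv.trans_apply, Equiv.apply_symm_apply] at h
  exact h.trans (add_comm _ _)

lemma formEquivSplitting_connectionEquivForm (hδ : IsHopfGalois δ) (s : StrongSplitting δ) :
    formEquivSplitting hδ (connectionEquivForm hδ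
      (differentialEquivConnection δ (splittingEquivDifferential δ s))) = s := by
  simp [formEquivSplitting, connectionEquivForm, differentialEquivConnection,
    splittingEquivVertical]

end Identifications

/-! ### Gauge equivariance of the identifications -/

section GaugeFormulas

variable {δ : P →ₐ[k] P ⊗[k] H} {f : (WithConv (H →ₗ[k] P))ˣ}

lemma toConv_incl_d_add (T : WithConv (H →ₗ[k] P)) :
    toConv (Omega.incl k P ∘ₗ d k ∘ₗ T.ofConv) + convMap H (inclLeft k P P) T =
      convMap H (inclRight k P P) T := by
  apply ofConv_injective
  rw [ofConv_add, ofConv_toConv, ← LinearMap.comp_assoc, incl_comp_d, LinearMap.sub_comp]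
  exact sub_add_cancel _ _

lemma gaugeConnection_add_inclLeft (hδ : IsCoaction δ) (f : (WithConv (H →ₗ[k] P))ˣ)
    (Q : Omega k P →ₗ[P] Omega k P) :
    gaugeConnection δ f Q + (inclLeft k P P).toLinearMap =
      gaugeTwist δ f (Omega.incl k P ∘ₗ Q.restrictScalars k ∘ₗ d k +
        (inclLeft k P P).toLinearMap) := by
  let N := (inclLeft k P P).toLinearMap ∘ₗ coactL δ f.val.ofConv
  let T := Omega.incl k P ∘ₗ d k ∘ₗ (f⁻¹).val.ofConv
  have hT : gaugeConnection δ f Q =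
      gaugeTwist δ f (Omega.incl k P ∘ₗ Q.restrictScalars k ∘ₗ d k) + coactMul δ N (toConv T) :=
    congrArg (gaugeTwist δ f (Omega.incl k P ∘ₗ Q.restrictScalars k ∘ₗ d k) +
      · ∘ₗ δ.toLinearMap) (actL_comp_map inclLeft_eq_smul_one (coactL δ f.val.ofConv) T)
  have hN : (inclLeft k P P).toLinearMap = coactMul δ N (convMap H (inclLeft k P P) (f⁻¹).val) := by
    rw [← algHom_comp_coactMul, coactMul_coactL_inv hδ, LinearMap.comp_id]
  rw [hT, gaugeTwist_add, add_assoc, gaugeTwist_eq_coactMul f (inclLeft k P P).toLinearMap,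
    ← toConv_incl_d_add, coactMul_add_right, ← hN]

lemma toConv_gaugeForm (f : (WithConv (H →ₗ[k] P))ˣ) (w : H →ₗ[k] Omega k P) :
    toConv (gaugeForm f w) =
      convMap H (inclLeft k P P) f.val *
          (toConv (Omega.incl k P ∘ₗ w) * convMap H (inclRight k P P) (f⁻¹).val) +
        convMap H (inclLeft k P P) f.val *
          toConv (Omega.incl k P ∘ₗ d k ∘ₗ (f⁻¹).val.ofConv) := by
  have hL (T : H →ₗ[k] P ⊗[k] P) :
      actL k P (P ⊗[k] P) ∘ₗ TensorProduct.map f.val.ofConv T ∘ₗ Coalgebra.comul =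
        (convMap H (inclLeft k P P) f.val * toConv T).ofConv :=
    congrArg (· ∘ₗ Coalgebra.comul) (actL_comp_map inclLeft_eq_smul_one f.val.ofConv T)
  have hR : actR k P P ∘ₗ TensorProduct.map (Omega.incl k P ∘ₗ w) f.inv.ofConv ∘ₗ Coalgebra.comul =
      (toConv (Omega.incl k P ∘ₗ w) * convMap H (inclRight k P P) (f⁻¹).val).ofConv :=
    congrArg (· ∘ₗ Coalgebra.comul) (actR_comp_map (Omega.incl k P ∘ₗ w) (f⁻¹).val.ofConv)
  rw [gaugeForm, hR, hL, hL]
  rfl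

lemma toConv_gaugeForm_add_one (f : (WithConv (H →ₗ[k] P))ˣ) (w : H →ₗ[k] Omega k P) :
    toConv (gaugeForm f w) + 1 = convMap H (inclLeft k P P) f.val *
      (toConv (Omega.incl k P ∘ₗ w) + 1) * convMap H (inclRight k P P) (f⁻¹).val := by
  have hd : convMap H (inclLeft k P P) f.val *
        toConv (Omega.incl k P ∘ₗ d k ∘ₗ (f⁻¹).val.ofConv) + 1 =
      convMap H (inclLeft k P P) f.val * convMap H (inclRight k P P) (f⁻¹).val := by
    rw [← toConv_incl_d_add, mul_add, ← map_mul (convMap H (inclLeft k P P)), Units.mul_inv,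
      map_one]
  rw [toConv_gaugeForm, add_assoc, hd, mul_add, mul_one, add_mul, mul_assoc]

lemma IsGauge.coactL_gaugeForm_add_inclLeft (hδ : IsCoaction δ) (hf : IsGauge δ f)
    (w : H →ₗ[k] Omega k P) :
    coactL δ (gaugeForm f w) + (inclLeft k P P).toLinearMap =
      gaugeTwist δ f (coactL δ (Omega.incl k P ∘ₗ w) + (inclLeft k P P).toLinearMap) := by
  have h (T : H →ₗ[k] P ⊗[k] P) : coactL δ T + (inclLeft k P P).toLinearMap =
      coactMul δ (inclLeft k P P).toLinearMap (toConv T + 1) := by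
    rw [coactMul_add_right, coactMul_one hδ, coactL_eq_coactMul inclLeft_eq_smul_one]
  rw [h, h, toConv_gaugeForm_add_one, gaugeTwist_eq_coactMul,
    coactMul_comp (hf.isColinear_coactL hδ), inclLeft_comp_coactL, coactMul_coactMul hδ,
    coactMul_coactMul hδ, toConv_ofConv, mul_assoc]

end GaugeFormulas

section Actions

variable {δ : P →ₐ[k] P ⊗[k] H}

/-- The splitting `p ↦ s(p₍₀₎ f(p₍₁₎)) f⁻¹(p₍₂₎)`. -/
def StrongSplitting.gaugeTransform (hδ : IsCoaction δ) {f : (WithConv (H →ₗ[k] P))ˣ}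
    (hf : IsGauge δ f) (s : StrongSplitting δ) : StrongSplitting δ where
  toMap :=
    { gaugeTwist δ f (s.toMap.restrictScalars k) with
      map_smul' := gaugeTwist_coinv_mul s.toMap }
  map_one := (gaugeTwist_apply_one hf _).trans s.map_one
  splits := LinearMap.congr_fun (mulB_comp_gaugeTwist hδ (LinearMap.ext s.splits))
  colinear := hf.isColinear_gaugeTwist hδ s.colinear

instance [hδ : Fact (IsCoaction δ)] : MulAction (gaugeGroup δ) (StrongSplitting δ) where
  smul f s := s.gaugeTransform hδ.out f.2
  one_smul _ := StrongSplitting.ext <| LinearMap.restrictScalars_injective k <|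
    gaugeTwist_one hδ.out _
  mul_smul f _ _ := StrongSplitting.ext <| LinearMap.restrictScalars_injective k <|
    IsGauge.gaugeTwist_mul hδ.out f.2 _

instance [hδ : Fact (IsHopfGalois δ)] : Fact (IsCoaction δ) := ⟨hδ.out.toIsCoaction⟩

section Coaction

variable [Fact (IsCoaction δ)]

instance : MulAction (gaugeGroup δ) (CovariantDifferential δ) :=
  (splittingEquivDifferential δ).symm.mulAction _

instance : MulAction (gaugeGroup δ) (VerticalDifferential δ) :=
  (splittingEquivVertical δ).symm.mulAction _

instance : MulAction (gaugeGroup δ) (StrongConnection δ) :=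
  (verticalEquivConnection δ).symm.mulAction _

lemma splittingEquivDifferential_smul (f : gaugeGroup δ) (s : StrongSplitting δ) :
    splittingEquivDifferential δ (f • s) = f • splittingEquivDifferential δ s :=
  congrArg (fun s ↦ splittingEquivDifferential δ (f • s))
    ((splittingEquivDifferential δ).symm_apply_apply s).symm

lemma splittingEquivVertical_smul (f : gaugeGroup δ) (s : StrongSplitting δ) :
    splittingEquivVertical δ (f • s) = f • splittingEquivVertical δ s :=
  congrArg (fun s ↦ splittingEquivVertical δ (f • s))
    ((splittingEquivVertical δ).symm_apply_apply s).symm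

lemma verticalEquivConnection_smul (f : gaugeGroup δ) (N : VerticalDifferential δ) :
    verticalEquivConnection δ (f • N) = f • verticalEquivConnection δ N :=
  congrArg (fun N ↦ verticalEquivConnection δ (f • N))
    ((verticalEquivConnection δ).symm_apply_apply N).symm

lemma differentialEquivConnection_smul (f : gaugeGroup δ) (D : CovariantDifferential δ) :
    differentialEquivConnection δ (f • D) = f • differentialEquivConnection δ D := by
  obtain ⟨s, rfl⟩ := (splittingEquivDifferential δ).surjective D
  rw [← splittingEquivDifferential_smul]
  exact (congrArg _ (splittingEquivVertical_smul f s)).trans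
    (verticalEquivConnection_smul f (splittingEquivVertical δ s))

lemma StrongSplitting.restrictScalars_smul (f : gaugeGroup δ) (s : StrongSplitting δ) :
    (f • s).toMap.restrictScalars k = gaugeTwist δ f (s.toMap.restrictScalars k) := rfl

lemma CovariantDifferential.toMap_smul (f : gaugeGroup δ) (D : CovariantDifferential δ) :
    (f • D).toMap = gaugeTwist δ f D.toMap := by
  have h (s : StrongSplitting δ) : s.toMap.restrictScalars k +
      (splittingEquivDifferential δ s).toMap = (inclRight k (coinv δ) P).toLinearMap :=
    add_sub_cancel (s.toMap.restrictScalars k) (inclRight k (coinv δ) P).toLinearMap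
  obtain ⟨s, rfl⟩ := (splittingEquivDifferential δ).surjective D
  have key : (f • s).toMap.restrictScalars k + (f • splittingEquivDifferential δ s).toMap =
      (f • s).toMap.restrictScalars k + gaugeTwist δ f (splittingEquivDifferential δ s).toMap := by
    rw [← splittingEquivDifferential_smul, h, StrongSplitting.restrictScalars_smul,
      ← gaugeTwist_add, h, gaugeTwist_inclRight Fact.out]
  exact LinearMap.ext fun p ↦ add_left_cancel (LinearMap.congr_fun key p)

lemma VerticalDifferential.incl_comp_smul (f : gaugeGroup δ) (N : VerticalDifferential δ) :
    Omega.incl k P ∘ₗ (f • N).toMap + (inclLeft k P P).toLinearMap =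
      gaugeTwist δ f (Omega.incl k P ∘ₗ N.toMap + (inclLeft k P P).toLinearMap) := by
  obtain ⟨s, rfl⟩ := (splittingEquivVertical δ).surjective N
  rw [← splittingEquivVertical_smul, ← inclB_comp_splitting, ← inclB_comp_splitting,
    StrongSplitting.restrictScalars_smul, inclB, rTensor_comp_gaugeTwist]

lemma StrongConnection.coe_smul_apply_smul_d (f : gaugeGroup δ) (Q : StrongConnection δ)
    (r p : P) :
    ((f • Q).toMap (r • d k p) : P ⊗[k] P) = r • gaugeConnection δ f Q.toMap p := by
  obtain ⟨N, rfl⟩ := (verticalEquivConnection δ).surjective Q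
  have h : Omega.incl k P ∘ₗ (f • N).toMap =
      gaugeConnection δ f (verticalEquivConnection δ N).toMap := by
    apply add_right_cancel (b := (inclLeft k P P).toLinearMap)
    rw [N.incl_comp_smul, gaugeConnection_add_inclLeft Fact.out]
    congr 3
    exact LinearMap.ext fun p ↦ (N.connection_d p).symm
  rw [map_smul, Submodule.coe_smul, ← h, ← verticalEquivConnection_smul]
  exact congrArg (fun x : Omega k P ↦ r • (x : P ⊗[k] P)) ((f • N).connection_d p)

end Coaction

variable [hδ : Fact (IsHopfGalois δ)]

instance : MulAction (gaugeGroup δ) (StrongConnectionForm δ) :=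
  (formEquivVertical hδ.out).mulAction _

lemma formEquivVertical_smul (f : gaugeGroup δ) (w : StrongConnectionForm δ) :
    formEquivVertical hδ.out (f • w) = f • formEquivVertical hδ.out w :=
  (formEquivVertical hδ.out).apply_symm_apply _

lemma connectionEquivForm_smul (f : gaugeGroup δ) (Q : StrongConnection δ) :
    connectionEquivForm hδ.out (f • Q) = f • connectionEquivForm hδ.out Q := by
  obtain ⟨N, rfl⟩ := (verticalEquivConnection δ).surjective Q
  obtain ⟨w, rfl⟩ := (formEquivVertical hδ.out).surjective N
  rw [← verticalEquivConnection_smul, ← formEquivVertical_smul]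
  simp only [connectionEquivForm, Equiv.trans_apply, Equiv.symm_apply_apply]

lemma formEquivSplitting_smul (f : gaugeGroup δ) (w : StrongConnectionForm δ) :
    formEquivSplitting hδ.out (f • w) = f • formEquivSplitting hδ.out w := by
  apply (splittingEquivVertical δ).injective
  simp only [formEquivSplitting, Equiv.trans_apply, splittingEquivVertical_smul,
    Equiv.apply_symm_apply, formEquivVertical_smul]

lemma StrongConnectionForm.coe_smul_apply (f : gaugeGroup δ) (w : StrongConnectionForm δ) (h : H) :
    ((f • w).toMap h : P ⊗[k] P) = gaugeForm f w.toMap h := by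
  have key : Omega.incl k P ∘ₗ (f • w).toMap = gaugeForm f w.toMap := by
    apply coactL_injective hδ.out
    apply add_right_cancel (b := (inclLeft k P P).toLinearMap)
    rw [IsGauge.coactL_gaugeForm_add_inclLeft Fact.out f.2, ← incl_comp_coactL, ← incl_comp_coactL]
    have hN : coactL δ (f • w).toMap = (f • formEquivVertical hδ.out w).toMap :=
      congrArg VerticalDifferential.toMap (formEquivVertical_smul f w)
    rw [hN, VerticalDifferential.incl_comp_smul]
    rfl
  exact LinearMap.congr_fun key h

end Actions

end HopfGalois

end

open HopfGalois in
theorem theorem4p1 {k H P : Type*} [Field k] [Ring H] [HopfAlgebra k H] [Ring P] [Algebra k P]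
    (δ : P →ₐ[k] P ⊗[k] H) (hδ : IsHopfGalois δ) (hne : Nonempty (StrongConnection δ)) :
    -- the identifications of the four descriptions
    ∃ (J₁ : StrongSplitting δ ≃ CovariantDifferential δ)
      (J₂ : CovariantDifferential δ ≃ StrongConnection δ)
      (J₃ : StrongConnection δ ≃ StrongConnectionForm δ)
      (J₄ : StrongConnectionForm δ ≃ StrongSplitting δ),
      (∀ s (p : P), (J₁ s).toMap p = 1 ⊗ₜ[k] p - s.toMap p) ∧
      (∀ D (r p : P), ((J₂ D).toMap (r • d k p) : P ⊗[k] P) = r • (d k p - inclB δ (D.toMap p))) ∧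
      (∀ Q h (t : P ⊗[k] P), (balancing δ).mkQ t = translation hδ h →
        (J₃ Q).toMap h =
          actL k P (Omega k P) ((Q.toMap.restrictScalars k ∘ₗ d k).lTensor P t)) ∧
      (∀ w (p : P), inclB δ ((J₄ w).toMap p) = p ⊗ₜ[k] 1 + (coactL δ w.toMap p : P ⊗[k] P)) ∧
      (∀ s, J₄ (J₃ (J₂ (J₁ s))) = s) ∧
      -- gauge transformations form a group under convolution
      ∃ G : Subgroup (WithConv (H →ₗ[k] P))ˣ, (∀ f, f ∈ G ↔ IsGauge δ f) ∧
      -- which acts from the left on each of the four sets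
      ∃ (_ : MulAction G (StrongSplitting δ)) (_ : MulAction G (CovariantDifferential δ))
        (_ : MulAction G (StrongConnection δ)) (_ : MulAction G (StrongConnectionForm δ)),
        (∀ (f : G) (s : StrongSplitting δ) p,
          (f • s).toMap p = gaugeTwist δ f (s.toMap.restrictScalars k) p) ∧
        (∀ (f : G) (D : CovariantDifferential δ) p,
          (f • D).toMap p = gaugeTwist δ f D.toMap p) ∧
        (∀ (f : G) (Q : StrongConnection δ) (r p : P),
          ((f • Q).toMap (r • d k p) : P ⊗[k] P) = r • gaugeConnection δ f Q.toMap p) ∧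
        (∀ (f : G) (w : StrongConnectionForm δ) h,
          ((f • w).toMap h : P ⊗[k] P) = gaugeForm f w.toMap h) ∧
        -- compatibly with the identifications
        (∀ (f : G) (s : StrongSplitting δ), J₁ (f • s) = f • J₁ s) ∧
        (∀ (f : G) (D : CovariantDifferential δ), J₂ (f • D) = f • J₂ D) ∧
        (∀ (f : G) (Q : StrongConnection δ), J₃ (f • Q) = f • J₃ Q) ∧
        (∀ (f : G) (w : StrongConnectionForm δ), J₄ (f • w) = f • J₄ w) := by
  have := Fact.mk hδ
  exact ⟨splittingEquivDifferential δ, differentialEquivConnection δ, connectionEquivForm hδ,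
    formEquivSplitting hδ, fun _ _ ↦ rfl, differentialEquivConnection_smul_d,
    fun Q _ _ ht ↦ connectionEquivForm_apply hδ Q ht, inclB_formEquivSplitting hδ,
    formEquivSplitting_connectionEquivForm hδ, gaugeGroup δ, fun _ ↦ Iff.rfl,
    inferInstance, inferInstance, inferInstance, inferInstance,
    fun f s ↦ LinearMap.congr_fun (s.restrictScalars_smul f),
    fun f D ↦ LinearMap.congr_fun (D.toMap_smul f),
    StrongConnection.coe_smul_apply_smul_d, StrongConnectionForm.coe_smul_apply,
    splittingEquivDifferential_smul, differentialEquivConnection_smul, connectionEquivForm_smul,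
    formEquivSplitting_smul⟩
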